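/- **Paul Lévy's theorem for the rectangular $R$-transform.** Fix $\lambda\in[0,1]$. Let $\sqrt{z}$ be the analytic square root on $\mathbb C\setminus[0,\infty)$ with $\sqrt{-1}=i$, and let $w^{1/2}$ be the principal square root. For a symmetric probability measure $\mu$ on $\mathbb R$ put $G_\mu(z)=\int \frac{d\mu(t)}{z-t}$ and $$H_\mu(z)=\lambda\, G_\mu\!\left(\tfrac1{\sqrt z}\right)^2+(1-\lambda)\sqrt z\,G_\mu\!\left(\tfrac1{\sqrt z}\right),\qquad z\in\mathbb C\setminus[0,\infty).$$ For $\alpha\in(0,\pi)$ and $\beta>0$ let $\Delta_{\alpha,\beta}=\{z\neq 0:\ |\arg z-\pi|<\alpha,\ |z|<\beta\}$, where $\arg z\in[0,2\pi)$. Let $H_\mu^{-1}$ be the inverse of $H_\mu$ near $0$ in sectors: for every $\alpha\in(0,\pi)$ it is analytic on some $\Delta_{\alpha,\beta}$, satisfies $H_\mu\circ H_\mu^{-1}=H_\mu^{-1}\circ H_\mu=\mathrm{id}$ on some $\Delta_{\alpha,\beta}$, and $H_\mu^{-1}(z)/z\to1$ as $z\to0$ with $|\arg z-\pi|<\alpha$.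 Let $U(z)=\frac{-\lambda-1+[(\lambda+1)^2+4\lambda z]^{1/2}}{2\lambda}$ if $\lambda\ne0$ and $U(z)=z$ if $\lambda=0$. The rectangular $R$-transform with ratio $\lambda$ of $\mu$ is the function $$C_\mu(z)=U\!\left(\frac{z}{H_\mu^{-1}(z)}-1\right),$$ defined near $0$ in sectors, and extended by analytic continuation along rays from $0$ to all points $z\in\mathbb C\setminus[0,\infty)$ for which this is possible (that is, for which it continues analytically to a neighbourhood of the segment $\{tz: 0<t\le1\}$). Below, a statement about values of $C_\mu$ on a set includes the assertion that $C_\mu$ is defined on that set; in particular, "$C_{\mu_n}(z)\to0$ as $z\to0$ in $S$, uniformly in $n$" means: for every $\varepsilon>0$ there is $\delta>0$ such that for all $n$ and all $z\in S$ with $0<|z|<\delta$, $C_{\mu_n}(z)$ is defined and $|C_{\mu_n}(z)|<\varepsilon$. Let $(\mu_n)$ be a sequence of symmetric probability measures on $\mathbb R$. Then the following are equivalent: (i) $(\mu_n)$ converges weakly to a symmetric probability measure; (ii) there exist $\alpha\in(0,\pi)$ and $\beta>0$ such that (a) $\displaystyle\lim_{z\to0,\ |\arg z-\pi|<\alpha}C_{\mu_n}(z)=0$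 uniformly in $n$, and (b) all $C_{\mu_n}$ are defined on $\Delta_{\alpha,\beta}$ and the sequence $(C_{\mu_n})$ converges, to some function, uniformly on every compact subset of $\Delta_{\alpha,\beta}$; (iii) (a) $\displaystyle\lim_{x\to0,\ x\in(-\infty,0)}C_{\mu_n}(x)=0$ uniformly in $n$, and (b) there exists $\beta>0$ such that all $C_{\mu_n}$ are defined on $[-\beta,0)$ and $(C_{\mu_n})$ converges pointwise on $[-\beta,0)$. Moreover, in this case, denoting by $\mu$ the weak limit of $(\mu_n)$, for every $\alpha\in(0,\pi)$ there exists $\beta>0$ such that $C_\mu$ and all $C_{\mu_n}$ are defined on $\Delta_{\alpha,\beta}$ and $(C_{\mu_n})$ converges to $C_\mu$ uniformly on every compact subset of $\Delta_{\alpha,\beta}$. -/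

import Mathlib

open Filter Topology MeasureTheory Set

noncomputable section

namespace RectFree

/-- A Borel measure on the real line is symmetric if it is invariant under `t ↦ -t`. -/
def IsSymmetric (μ : Measure ℝ) : Prop :=
  μ.map (fun t : ℝ => -t) = μ

/-- The square root on `ℂ ∖ [0, ∞)` with `√(-1) = i`. -/
def sqrtNeg (z : ℂ) : ℂ :=
  Complex.I * (-z) ^ (1 / 2 : ℂ)

/-- `ℂ ∖ [0, ∞)`. -/
def slit : Set ℂ :=
  {z : ℂ | -z ∈ Complex.slitPlane}

/-- The open sector of the `z ≠ 0` with `|arg z - π| < α`, for the argument in `[0, 2π)`; this is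
`|arg (-z)| < α` for the principal argument. -/
def sector (α : ℝ) : Set ℂ :=
  {z : ℂ | z ≠ 0 ∧ |Complex.arg (-z)| < α}

/-- The truncated sector `Δ_{α,β}`: the `z` with `|arg z - π| < α` and `0 < |z| < β`. -/
def Delta (α β : ℝ) : Set ℂ :=
  {z : ℂ | z ∈ sector α ∧ ‖z‖ < β}

/-- The Cauchy transform `G_μ(z) = ∫ dμ(t) / (z - t)`. -/
def cauchyTransform (μ : Measure ℝ) (z : ℂ) : ℂ :=
  ∫ t : ℝ, 1 / (z - (t : ℂ)) ∂μ

/-- The rectangular Cauchy transform `H_μ` with ratio `lam`, to be used on `ℂ ∖ [0, ∞)`. -/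
def rectCauchy (lam : ℝ) (μ : Measure ℝ) (z : ℂ) : ℂ :=
  (lam : ℂ) * cauchyTransform μ (1 / sqrtNeg z) ^ 2 +
    (1 - (lam : ℂ)) * sqrtNeg z * cauchyTransform μ (1 / sqrtNeg z)

/-- The branch `U` of the inverse of `z ↦ (lam z + 1)(z + 1) - 1` with `U 0 = 0`. -/
def rectU (lam : ℝ) (z : ℂ) : ℂ :=
  if lam = 0 then z
  else (-(lam : ℂ) - 1 + (((lam : ℂ) + 1) ^ 2 + 4 * (lam : ℂ) * z) ^ (1 / 2 : ℂ)) /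
    (2 * (lam : ℂ))

/-- `F` is an inverse of `H` near `0` in sectors: for every `α ∈ (0, π)`, `F` is analytic on some
`Δ_{α,β}`, `F z / z → 1` as `z → 0` with `|arg z - π| < α`, and `H ∘ F = F ∘ H = id` on some
`Δ_{α,β}`. -/
def IsSectorInverse (H F : ℂ → ℂ) : Prop :=
  ∀ α : ℝ, 0 < α → α < Real.pi →
    (∃ β : ℝ, 0 < β ∧ AnalyticOnNhd ℂ F (Delta α β)) ∧
    Tendsto (fun z : ℂ => F z / z) (𝓝[sector α] 0) (𝓝 1) ∧
    ∃ β : ℝ, 0 < β ∧ ∀ z ∈ Delta α β, H (F z) = z ∧ F (H z) = z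

/-- `C` is, on the open set `D`, an analytic determination of the rectangular R-transform of `μ`
with ratio `lam`. Here `D ⊆ ℂ ∖ [0, ∞)` is closed under `z ↦ t z` for `0 < t ≤ 1` and contains for
each `α ∈ (0, π)` some `Δ_{α,β}`, and near `0` in sectors `C z = U (z / H_μ⁻¹ z - 1)`. -/
structure IsRTransformOn (lam : ℝ) (μ : Measure ℝ) (D : Set ℂ) (C : ℂ → ℂ) : Prop where
  isOpen : IsOpen D
  subset_slit : D ⊆ slit
  star : ∀ z ∈ D, ∀ t : ℝ, 0 < t → t ≤ 1 → (t : ℂ) * z ∈ D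
  sectors : ∀ α : ℝ, 0 < α → α < Real.pi → ∃ β : ℝ, 0 < β ∧ Delta α β ⊆ D
  analytic : AnalyticOnNhd ℂ C D
  germ : ∃ F : ℂ → ℂ, IsSectorInverse (rectCauchy lam μ) F ∧
    ∀ α : ℝ, 0 < α → α < Real.pi →
      ∃ β : ℝ, 0 < β ∧ ∀ z ∈ Delta α β, C z = rectU lam (z / F z - 1)

/-- The domain of the rectangular R-transform `C_μ`: the points to which the function
`U (z / H_μ⁻¹ z - 1)`, given near `0` in sectors, extends analytically along rays from `0`. -/
def rectRDomain (lam : ℝ) (μ : Measure ℝ) : Set ℂ :=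
  {z : ℂ | ∃ (D : Set ℂ) (C : ℂ → ℂ), IsRTransformOn lam μ D C ∧ z ∈ D}

open Classical in
/-- The rectangular R-transform `C_μ` with ratio `lam`, on `rectRDomain lam μ` (the value `0`
elsewhere has no meaning). The value does not depend on the choice of `D` and `C`, see
`rectR_eq`. -/
def rectR (lam : ℝ) (μ : Measure ℝ) (z : ℂ) : ℂ :=
  if h : ∃ (D : Set ℂ) (C : ℂ → ℂ), IsRTransformOn lam μ D C ∧ z ∈ D then
    h.choose_spec.choose z
  else 0

/-- Two sector inverses of the same function agree near `0` in every sector. -/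
theorem IsSectorInverse.eq_on {H F F' : ℂ → ℂ} (hF : IsSectorInverse H F)
    (hF' : IsSectorInverse H F') {α : ℝ} (h0 : 0 < α) (hπ : α < Real.pi) :
    ∃ β : ℝ, 0 < β ∧ ∀ z ∈ Delta α β, F z = F' z := by
  obtain ⟨α', hα, hα'⟩ := exists_between hπ
  obtain ⟨-, -, b, hb, hinv⟩ := hF α' (h0.trans hα) hα'
  obtain ⟨-, hlim, b', hb', hinv'⟩ := hF' α h0 hπ
  -- `F' z` lies in the larger truncated sector `Δ_{α',b}`
  have hbig : ∀ᶠ z in 𝓝[sector α] (0 : ℂ), F' z ∈ Delta α' b := by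
    have hη : 0 < α' - α := sub_pos.2 hα
    have harg : ∀ᶠ w in 𝓝 (1 : ℂ), |Complex.arg w| < α' - α := by
      have hc : ContinuousAt Complex.arg 1 := Complex.continuousAt_arg (by simp)
      have := hc.abs.tendsto
      simp only [Complex.arg_one, abs_zero] at this
      exact this.eventually_lt_const hη
    have hnorm : ∀ᶠ w in 𝓝 (1 : ℂ), ‖w‖ < 2 :=
      continuous_norm.continuousAt.eventually_lt_const (by simp)
    have hne : ∀ᶠ w in 𝓝 (1 : ℂ), w ≠ 0 := eventually_ne_nhds one_ne_zero
    have hz : ∀ᶠ z in 𝓝[sector α] (0 : ℂ), ‖z‖ < b / 2 :=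
      nhdsWithin_le_nhds
        (continuous_norm.continuousAt.eventually_lt_const (by simpa using half_pos hb))
    filter_upwards [hlim.eventually harg, hlim.eventually hnorm, hlim.eventually hne, hz,
      self_mem_nhdsWithin] with z h1 h2 h3 h4 h5
    have hz0 : z ≠ 0 := h5.1
    have hFz : F' z = F' z / z * z := by field_simp
    have h6 : -F' z = F' z / z * -z := by rw [mul_neg, ← hFz]
    have hsum : |Complex.arg (F' z / z) + Complex.arg (-z)| < α' := by
      have := abs_add_le (Complex.arg (F' z / z)) (Complex.arg (-z))
      have := h5.2
      linarith
    refine ⟨⟨?_, ?_⟩, ?_⟩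
    · rw [hFz]; exact mul_ne_zero h3 hz0
    · rw [h6, Complex.arg_mul h3 (neg_ne_zero.2 hz0)]
      · exact hsum
      · have := abs_lt.1 hsum
        constructor <;> linarith [this.1, this.2]
    · rw [hFz, norm_mul]
      have := norm_nonneg z
      have := norm_nonneg (F' z / z)
      nlinarith
  obtain ⟨c, hc, hcs⟩ := Metric.mem_nhdsWithin_iff.1 hbig
  refine ⟨min b' c, lt_min hb' hc, fun z hz => ?_⟩
  have hz1 : z ∈ Delta α b' := ⟨hz.1, hz.2.trans_le (min_le_left _ _)⟩
  have hz2 : F' z ∈ Delta α' b :=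
    hcs ⟨by simpa using hz.2.trans_le (min_le_right _ _), hz.1⟩
  have h := (hinv _ hz2).2
  rwa [(hinv' z hz1).1] at h

theorem IsRTransformOn.eq {lam : ℝ} {μ : Measure ℝ} {D D' : Set ℂ} {C C' : ℂ → ℂ}
    (h : IsRTransformOn lam μ D C) (h' : IsRTransformOn lam μ D' C') {z : ℂ}
    (hz : z ∈ D) (hz' : z ∈ D') : C z = C' z := by
  obtain ⟨F, hF, hC⟩ := h.germ
  obtain ⟨F', hF', hC'⟩ := h'.germ
  have hslit := h.subset_slit hz
  have hz0 : z ≠ 0 := by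
    rintro rfl
    simp [slit] at hslit
  have hargπ : |Complex.arg (-z)| < Real.pi := by
    have h1 := Complex.mem_slitPlane_iff_arg.1 hslit
    rw [abs_lt]
    exact ⟨Complex.neg_pi_lt_arg _, lt_of_le_of_ne (Complex.arg_le_pi _) h1.1⟩
  obtain ⟨α, hα, hαπ⟩ := exists_between hargπ
  have hα0 : 0 < α := (abs_nonneg _).trans_lt hα
  obtain ⟨b, hb, hbC⟩ := hC α hα0 hαπ
  obtain ⟨b', hb', hbC'⟩ := hC' α hα0 hαπ
  obtain ⟨c, hc, hcF⟩ := hF.eq_on hF' hα0 hαπ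
  set r := min (min b b') c with hr
  have hr0 : 0 < r := lt_min (lt_min hb hb') hc
  have hCC : ∀ w ∈ Delta α r, C w = C' w := by
    intro w hw
    rw [hbC w ⟨hw.1, hw.2.trans_le ((min_le_left _ _).trans (min_le_left _ _))⟩,
      hbC' w ⟨hw.1, hw.2.trans_le ((min_le_left _ _).trans (min_le_right _ _))⟩,
      hcF w ⟨hw.1, hw.2.trans_le (min_le_right _ _)⟩]
  -- the identity theorem along the segment from `0` to `z`
  set S : Set ℂ := (fun t : ℝ => (t : ℂ) * z) '' Ioc 0 1 with hS
  have hSpre : IsPreconnected S :=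
    isPreconnected_Ioc.image _ (by fun_prop)
  have hSD : S ⊆ D := by
    rintro _ ⟨t, ht, rfl⟩
    exact h.star z hz t ht.1 ht.2
  have hSD' : S ⊆ D' := by
    rintro _ ⟨t, ht, rfl⟩
    exact h'.star z hz' t ht.1 ht.2
  have hzS : z ∈ S := ⟨1, by simp, by simp⟩
  have hnz : 0 < ‖z‖ := norm_pos_iff.2 hz0
  set t : ℝ := min 1 (r / (2 * ‖z‖)) with ht
  have ht0 : 0 < t := lt_min one_pos (by positivity)
  have ht1 : t ≤ 1 := min_le_left _ _
  have hargt : Complex.arg (-((t : ℂ) * z)) = Complex.arg (-z) := by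
    rw [← mul_neg, Complex.arg_real_mul _ ht0]
  have hnt : ‖(t : ℂ) * z‖ < r := by
    rw [norm_mul, Complex.norm_real, Real.norm_of_nonneg ht0.le]
    calc t * ‖z‖ ≤ r / (2 * ‖z‖) * ‖z‖ := by gcongr; exact min_le_right _ _
      _ = r / 2 := by field_simp
      _ < r := by linarith
  have hev : C =ᶠ[𝓝 ((t : ℂ) * z)] C' := by
    have htslit : -((t : ℂ) * z) ∈ Complex.slitPlane :=
      h.subset_slit (h.star z hz t ht0 ht1)
    have hcont : ContinuousAt (fun w : ℂ => |Complex.arg (-w)|) ((t : ℂ) * z) :=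
      ((Complex.continuousAt_arg htslit).comp (f := fun w : ℂ => -w)
        continuous_neg.continuousAt).abs
    have hlt : |Complex.arg (-((t : ℂ) * z))| < α := by rw [hargt]; exact hα
    filter_upwards [hcont.eventually_lt_const hlt,
      continuous_norm.continuousAt.eventually_lt_const hnt,
      eventually_ne_nhds (mul_ne_zero (by exact_mod_cast ht0.ne') hz0)] with w h1 h2 h3
    exact hCC w ⟨⟨h3, h1⟩, h2⟩
  exact (h.analytic.mono hSD).eqOn_of_preconnected_of_eventuallyEq (h'.analytic.mono hSD')
    hSpre ⟨t, ⟨ht0, ht1⟩, rfl⟩ hev hzS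

/-- Every analytic determination of the rectangular R-transform is a restriction of `rectR`. -/
theorem rectR_eq {lam : ℝ} {μ : Measure ℝ} {D : Set ℂ} {C : ℂ → ℂ}
    (h : IsRTransformOn lam μ D C) {z : ℂ} (hz : z ∈ D) : rectR lam μ z = C z := by
  have hex : ∃ (D : Set ℂ) (C : ℂ → ℂ), IsRTransformOn lam μ D C ∧ z ∈ D := ⟨D, C, h, hz⟩
  rw [rectR, dif_pos hex]
  exact hex.choose_spec.choose_spec.1.eq h hex.choose_spec.choose_spec.2 hz

end RectFree

end

noncomputable section

namespace RectFree

/-! For symmetric `μ`, averaging the Cauchy kernel over `t` and `-t` gives `H_μ(z) = z T(ψ_μ(z))`,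
with `T = rectT` and `ψ_μ = psi μ` (`rectCauchy_eq`). Since `U` satisfies `T(U(y)) = 1 + y`, near
`0` the transform `C_μ(z)` is `ψ_μ(H_μ⁻¹(z))`, that is `ψ_μ(z / T(C_μ(z))) = C_μ(z)`. This identity
translates between the measure and its R-transform in both directions.

From measures to transforms: `ψ_μ` is bounded in a sector by `tail μ`, so on a tight family it is
small uniformly near `0`, and the `H_μ` are uniformly tangent to the identity
(`TightSymmetric.tangentToId`). A contraction argument then inverts all of them on one common
truncated sector, with uniform bounds (`TangentToId.exists_invertsAt`). Weak convergence gives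
pointwise convergence of `ψ`, hence of the inverses and of the R-transforms. Bounded holomorphic
functions are equicontinuous, so the convergence is uniform on compact sets
(`exists_tendstoUniformlyOn_rectR`).

From transforms to measures: as long as `C_μ` is small on the negative axis, the identity continues
analytically along it (`psi_div_rectT_rectR`). The value of `ψ_μ` at a point of the left half-plane
controls the mass of `μ` far from `0`, so uniform smallness of the `C_{μ_n}` gives tightness
(`isTightMeasureSet_of_rectR`). By Prokhorov it remains to identify subsequential limits. Their
R-transforms agree on an interval `(-β, 0)`, so their `ψ` agree on a set with an accumulation point,
hence on `ℂ ∖ [0, ∞)`, and `ψ` determines a symmetric measure through a moment problem on `[0, 1]`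
(`IsSymmetric.ext_of_rectR`, `IsSymmetric.ext_of_psi`).

Sectors are described throughout by `k ‖z‖ < aperture z` with `k > 0`, where `k = 1 + cos α`. This
replaces arguments by a Lipschitz function and makes widening a sector the same as decreasing `k`.
-/

/-! ### Geometry of sectors -/

/-- `‖z‖ - Re z`, which is positive exactly on `ℂ ∖ [0, ∞)`; on the ray of argument `π + θ` it is
`‖z‖ (1 + cos θ)`. -/
def aperture (z : ℂ) : ℝ := ‖z‖ - z.re

theorem aperture_nonneg (z : ℂ) : 0 ≤ aperture z := sub_nonneg.2 (Complex.re_le_norm z)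

theorem aperture_le (z : ℂ) : aperture z ≤ 2 * ‖z‖ := by
  have := (abs_le.1 (Complex.abs_re_le_norm z)).1
  unfold aperture; linarith

theorem continuous_aperture : Continuous aperture := by
  unfold aperture; fun_prop

theorem aperture_sub_le (z w : ℂ) : aperture z - aperture w ≤ 2 * ‖z - w‖ := by
  have h1 := norm_sub_norm_le z w
  have h2 := (abs_le.1 (Complex.abs_re_le_norm (z - w))).1
  rw [Complex.sub_re] at h2
  unfold aperture; linarith

theorem mem_slit_iff {z : ℂ} : z ∈ slit ↔ 0 < aperture z := by
  unfold slit aperture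
  rw [Set.mem_ofPred_eq, Complex.mem_slitPlane_iff]
  simp only [Complex.neg_re, Complex.neg_im, ne_eq, neg_eq_zero, Left.neg_pos_iff]
  constructor
  · rintro (h | h)
    · have := norm_nonneg z; linarith
    · have := Complex.abs_re_lt_norm.2 h
      linarith [le_abs_self z.re]
  · intro h
    by_contra! hc
    obtain ⟨h0, h1⟩ := hc
    have : z = (z.re : ℂ) := Complex.ext (by simp) (by simp [h1])
    rw [this, Complex.norm_real, Real.norm_of_nonneg h0] at h
    simp at h

theorem isOpen_slit : IsOpen slit := by
  have : slit = aperture ⁻¹' Ioi 0 := by ext z; exact mem_slit_iff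
  rw [this]
  exact isOpen_Ioi.preimage continuous_aperture

theorem ne_zero_of_mem_slit {z : ℂ} (hz : z ∈ slit) : z ≠ 0 := by
  rintro rfl
  rw [mem_slit_iff] at hz
  simp [aperture] at hz

theorem mem_sector_iff {α : ℝ} (h0 : 0 < α) (hπ : α < Real.pi) {z : ℂ} :
    z ∈ sector α ↔ (1 + Real.cos α) * ‖z‖ < aperture z := by
  by_cases hz : z = 0
  · simp [hz, sector, aperture]
  have hn : 0 < ‖z‖ := norm_pos_iff.2 hz
  have hcos : Real.cos |Complex.arg (-z)| = -z.re / ‖z‖ := by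
    rw [Real.cos_abs, Complex.cos_arg (neg_ne_zero.2 hz)]; simp
  have hiff : |Complex.arg (-z)| < α ↔ Real.cos α < Real.cos |Complex.arg (-z)| :=
    (Real.strictAntiOn_cos.lt_iff_gt ⟨h0.le, hπ.le⟩
      ⟨abs_nonneg _, Complex.abs_arg_le_pi _⟩).symm
  unfold sector aperture
  rw [Set.mem_ofPred_eq, hiff, hcos, lt_div_iff₀ hn]
  constructor
  · rintro ⟨-, h⟩; linarith
  · intro h; exact ⟨hz, by linarith⟩

theorem one_add_cos_pos {α : ℝ} (h0 : 0 < α) (hπ : α < Real.pi) : 0 < 1 + Real.cos α := by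
  have := Real.strictAntiOn_cos ⟨h0.le, hπ.le⟩ ⟨Real.pi_pos.le, le_rfl⟩ hπ
  rw [Real.cos_pi] at this
  linarith

theorem mem_Delta_iff {α β : ℝ} (h0 : 0 < α) (hπ : α < Real.pi) {z : ℂ} :
    z ∈ Delta α β ↔ (1 + Real.cos α) * ‖z‖ < aperture z ∧ ‖z‖ < β := by
  unfold Delta
  rw [Set.mem_ofPred_eq, mem_sector_iff h0 hπ]

theorem isOpen_Delta {α β : ℝ} (h0 : 0 < α) (hπ : α < Real.pi) : IsOpen (Delta α β) := by
  have : Delta α β = {z | (1 + Real.cos α) * ‖z‖ < aperture z} ∩ {z | ‖z‖ < β} := by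
    ext z; exact mem_Delta_iff h0 hπ
  rw [this]
  exact (isOpen_lt (by fun_prop) continuous_aperture).inter (isOpen_lt (by fun_prop) (by fun_prop))

theorem Delta_mono {α β β' : ℝ} (h : β ≤ β') : Delta α β ⊆ Delta α β' :=
  fun _ hz => ⟨hz.1, hz.2.trans_le h⟩

theorem Delta_subset_slit {α β : ℝ} (h0 : 0 < α) (hπ : α < Real.pi) : Delta α β ⊆ slit := by
  intro z hz
  rw [mem_slit_iff]
  have := ((mem_Delta_iff h0 hπ).1 hz).1
  exact (mul_nonneg (one_add_cos_pos h0 hπ).le (norm_nonneg z)).trans_lt this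

theorem aperture_real_mul {t : ℝ} (ht : 0 ≤ t) (z : ℂ) : aperture (t * z) = t * aperture z := by
  unfold aperture
  rw [norm_mul, Complex.norm_real, Real.norm_of_nonneg ht]
  simp; ring

theorem Delta_star {α β : ℝ} (h0 : 0 < α) (hπ : α < Real.pi) {z : ℂ} (hz : z ∈ Delta α β)
    {t : ℝ} (ht : 0 < t) (ht1 : t ≤ 1) : (t : ℂ) * z ∈ Delta α β := by
  rw [mem_Delta_iff h0 hπ] at hz ⊢
  rw [aperture_real_mul ht.le, norm_mul, Complex.norm_real, Real.norm_of_nonneg ht.le]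
  constructor
  · nlinarith [hz.1]
  · nlinarith [hz.2, norm_nonneg z]

theorem ofReal_mem_Delta {α β x : ℝ} (h0 : 0 < α) (hx : x < 0) (hβ : -β < x) :
    (x : ℂ) ∈ Delta α β := by
  refine ⟨⟨by exact_mod_cast hx.ne, ?_⟩, ?_⟩
  · rw [← Complex.ofReal_neg, Complex.arg_ofReal_of_nonneg (by linarith)]
    simpa using h0
  · rw [Complex.norm_real, Real.norm_of_nonpos hx.le]; linarith

theorem ofReal_mem_slit {x : ℝ} (hx : x < 0) : (x : ℂ) ∈ slit := by
  rw [mem_slit_iff, aperture, Complex.norm_real, Real.norm_of_nonpos hx.le, Complex.ofReal_re]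
  linarith

theorem one_sub_mul_ne_zero {z : ℂ} (hz : z ∈ slit) {x : ℝ} (hx : 0 ≤ x) :
    1 - z * (x : ℂ) ≠ 0 := by
  intro h
  have h1 : z * (x : ℂ) = 1 := (sub_eq_zero.1 h).symm
  have hx0 : x ≠ 0 := by rintro rfl; simp at h1
  have h2 : z = ((1 / x : ℝ) : ℂ) := by
    push_cast
    rw [eq_div_iff (by exact_mod_cast hx0), h1]
  rw [mem_slit_iff, h2, aperture, Complex.norm_real, Real.norm_of_nonneg (by positivity),
    Complex.ofReal_re] at hz
  simp at hz

/-- The difference of the two sides is exactly `(‖z‖ + Re z) (1 - ‖z‖ x) ^ 2`. -/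
theorem aperture_mul_sq_le (z : ℂ) {x : ℝ} :
    aperture z * (1 + ‖z‖ * x) ^ 2 ≤ 2 * ‖z‖ * ‖1 - z * (x : ℂ)‖ ^ 2 := by
  have h1 : ‖1 - z * (x : ℂ)‖ ^ 2 = 1 - 2 * x * z.re + x ^ 2 * ‖z‖ ^ 2 := by
    rw [← Complex.normSq_eq_norm_sq, ← Complex.normSq_eq_norm_sq, Complex.normSq_apply,
      Complex.normSq_apply]
    simp; ring
  rw [h1]
  have h2 := (abs_le.1 (Complex.abs_re_le_norm z)).1
  unfold aperture
  nlinarith [mul_nonneg (by linarith : 0 ≤ ‖z‖ + z.re) (sq_nonneg (1 - ‖z‖ * x))]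

/-- In a sector the denominator of the `ψ` kernel is comparable to its value on the negative axis.
The bound `aperture z ≤ 2 ‖z‖` forces `k ≤ 2`, so `k² / 4 ≤ k / 2` when roots are taken in
`aperture_mul_sq_le`. -/
theorem le_norm_one_sub_mul {k : ℝ} (hk : 0 < k) {z : ℂ} (hz : k * ‖z‖ < aperture z) (x : ℝ) :
    k / 2 * (1 + ‖z‖ * x) ≤ ‖1 - z * (x : ℂ)‖ := by
  have hn : 0 < ‖z‖ := by
    rcases (norm_nonneg z).eq_or_lt with h | h
    · have := aperture_le z
      rw [← h] at this hz; linarith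
    · exact h
  have hk2 : k ≤ 2 := by
    by_contra! h
    have := aperture_le z
    nlinarith
  have h1 := aperture_mul_sq_le z (x := x)
  have h2 : k * ‖z‖ * (1 + ‖z‖ * x) ^ 2 ≤ 2 * ‖z‖ * ‖1 - z * (x : ℂ)‖ ^ 2 :=
    (mul_le_mul_of_nonneg_right hz.le (sq_nonneg _)).trans h1
  have h3 : k * (1 + ‖z‖ * x) ^ 2 ≤ 2 * ‖1 - z * (x : ℂ)‖ ^ 2 := by
    by_contra! h
    nlinarith [mul_lt_mul_of_pos_left h hn]
  refine le_of_sq_le_sq ?_ (norm_nonneg _)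
  have h4 : 0 ≤ (1 + ‖z‖ * x) ^ 2 := sq_nonneg _
  nlinarith [mul_nonneg (mul_nonneg hk.le (by linarith : 0 ≤ 2 - k)) h4]

/-! ### The moment generating function `ψ_μ` -/

/-- The even moment generating function `ψ_μ(z) = ∫ z t² / (1 - z t²) dμ(t)`. -/
def psi (μ : Measure ℝ) (z : ℂ) : ℂ :=
  ∫ t : ℝ, z * ((t ^ 2 : ℝ) : ℂ) / (1 - z * ((t ^ 2 : ℝ) : ℂ)) ∂μ

/-- `-ψ_μ(-s)` for `s ≥ 0`: a measure of the mass of `μ` outside `[-s^{-1/2}, s^{-1/2}]`. -/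
def tail (μ : Measure ℝ) (s : ℝ) : ℝ := ∫ t : ℝ, s * t ^ 2 / (1 + s * t ^ 2) ∂μ

theorem tail_integrand_mem {s : ℝ} (hs : 0 ≤ s) (t : ℝ) :
    0 ≤ s * t ^ 2 / (1 + s * t ^ 2) ∧ s * t ^ 2 / (1 + s * t ^ 2) ≤ 1 := by
  have : 0 ≤ s * t ^ 2 := by positivity
  exact ⟨by positivity, (div_le_one (by linarith)).2 (by linarith)⟩

theorem continuous_tail_integrand {s : ℝ} (hs : 0 ≤ s) :
    Continuous fun t : ℝ => s * t ^ 2 / (1 + s * t ^ 2) := by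
  refine Continuous.div (by fun_prop) (by fun_prop) fun t => ?_
  positivity

theorem integrable_tail_integrand (μ : Measure ℝ) [IsFiniteMeasure μ] {s : ℝ} (hs : 0 ≤ s) :
    Integrable (fun t : ℝ => s * t ^ 2 / (1 + s * t ^ 2)) μ := by
  refine Integrable.of_bound (continuous_tail_integrand hs).aestronglyMeasurable 1
    (Eventually.of_forall fun t => ?_)
  rw [Real.norm_of_nonneg (tail_integrand_mem hs t).1]
  exact (tail_integrand_mem hs t).2

theorem tail_mono (μ : Measure ℝ) [IsFiniteMeasure μ] {s s' : ℝ} (hs : 0 ≤ s) (h : s ≤ s') :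
    tail μ s ≤ tail μ s' := by
  refine integral_mono (integrable_tail_integrand μ hs) (integrable_tail_integrand μ (hs.trans h))
    fun t => ?_
  have h1 : s * t ^ 2 ≤ s' * t ^ 2 := by gcongr
  have h0 : 0 ≤ s * t ^ 2 := by positivity
  change s * t ^ 2 / (1 + s * t ^ 2) ≤ s' * t ^ 2 / (1 + s' * t ^ 2)
  rw [div_le_div_iff₀ (by linarith) (by linarith)]
  nlinarith

theorem tendsto_tail_zero (μ : Measure ℝ) [IsFiniteMeasure μ] :
    Tendsto (tail μ) (𝓝[>] 0) (𝓝 0) := by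
  suffices h : Tendsto (tail μ) (𝓝[>] 0) (𝓝 (∫ _ : ℝ, (0 : ℝ) ∂μ)) by simpa using h
  refine tendsto_integral_filter_of_dominated_convergence (fun _ => (1 : ℝ)) ?_ ?_
    (integrable_const _) ?_
  · filter_upwards [self_mem_nhdsWithin] with s hs
    exact (continuous_tail_integrand (le_of_lt hs)).aestronglyMeasurable
  · filter_upwards [self_mem_nhdsWithin] with s hs
    refine Eventually.of_forall fun t => ?_
    rw [Real.norm_of_nonneg (tail_integrand_mem (le_of_lt hs) t).1]
    exact (tail_integrand_mem (le_of_lt hs) t).2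
  · refine Eventually.of_forall fun t => ?_
    have hc : ContinuousAt (fun s : ℝ => s * t ^ 2 / (1 + s * t ^ 2)) 0 :=
      ContinuousAt.div (by fun_prop) (by fun_prop) (by simp)
    have := hc.tendsto
    simp only [zero_mul, zero_div] at this
    exact this.mono_left nhdsWithin_le_nhds

theorem norm_psi_integrand_le {k : ℝ} (hk : 0 < k) {z : ℂ} (hz : k * ‖z‖ < aperture z) (t : ℝ) :
    ‖z * ((t ^ 2 : ℝ) : ℂ) / (1 - z * ((t ^ 2 : ℝ) : ℂ))‖ ≤
      2 / k * (‖z‖ * t ^ 2 / (1 + ‖z‖ * t ^ 2)) := by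
  have h := le_norm_one_sub_mul hk hz (t ^ 2)
  have hpos : 0 < k / 2 * (1 + ‖z‖ * t ^ 2) := by positivity
  rw [norm_div, norm_mul, Complex.norm_real, Real.norm_of_nonneg (sq_nonneg t)]
  calc _ ≤ ‖z‖ * t ^ 2 / (k / 2 * (1 + ‖z‖ * t ^ 2)) := by gcongr
    _ = _ := by field_simp

theorem continuous_psi_integrand {z : ℂ} (hz : z ∈ slit) :
    Continuous fun t : ℝ => z * ((t ^ 2 : ℝ) : ℂ) / (1 - z * ((t ^ 2 : ℝ) : ℂ)) := by
  refine Continuous.div ?_ ?_ fun t => one_sub_mul_ne_zero hz (sq_nonneg t)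
  · exact continuous_const.mul (Complex.continuous_ofReal.comp (by fun_prop))
  · exact continuous_const.sub
      (continuous_const.mul (Complex.continuous_ofReal.comp (by fun_prop)))

theorem exists_lt_aperture {z : ℂ} (hz : z ∈ slit) : ∃ k : ℝ, 0 < k ∧ k * ‖z‖ < aperture z := by
  have hn := norm_pos_iff.2 (ne_zero_of_mem_slit hz)
  have ha := mem_slit_iff.1 hz
  refine ⟨aperture z / (2 * ‖z‖), by positivity, ?_⟩
  have : aperture z / (2 * ‖z‖) * ‖z‖ = aperture z / 2 := by field_simp
  rw [this]; linarith

theorem exists_bound_psi_integrand {z : ℂ} (hz : z ∈ slit) :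
    ∃ B : ℝ, ∀ t : ℝ, ‖z * ((t ^ 2 : ℝ) : ℂ) / (1 - z * ((t ^ 2 : ℝ) : ℂ))‖ ≤ B := by
  obtain ⟨k, hk, hkz⟩ := exists_lt_aperture hz
  refine ⟨2 / k * 1, fun t => (norm_psi_integrand_le hk hkz t).trans ?_⟩
  gcongr
  exact (tail_integrand_mem (norm_nonneg z) t).2

theorem integrable_psi_integrand (μ : Measure ℝ) [IsFiniteMeasure μ] {z : ℂ} (hz : z ∈ slit) :
    Integrable (fun t : ℝ => z * ((t ^ 2 : ℝ) : ℂ) / (1 - z * ((t ^ 2 : ℝ) : ℂ))) μ := by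
  obtain ⟨B, hB⟩ := exists_bound_psi_integrand hz
  exact Integrable.of_bound (continuous_psi_integrand hz).aestronglyMeasurable B
    (Eventually.of_forall hB)

theorem norm_psi_le (μ : Measure ℝ) [IsFiniteMeasure μ] {k : ℝ} (hk : 0 < k) {z : ℂ}
    (hz : k * ‖z‖ < aperture z) : ‖psi μ z‖ ≤ 2 / k * tail μ ‖z‖ := by
  unfold psi tail
  rw [← integral_const_mul]
  exact norm_integral_le_of_norm_le ((integrable_tail_integrand μ (norm_nonneg z)).const_mul _)
    (Eventually.of_forall (norm_psi_integrand_le hk hz))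

theorem differentiableAt_psi (μ : Measure ℝ) [IsFiniteMeasure μ] {z : ℂ} (hz : z ∈ slit) :
    DifferentiableAt ℂ (psi μ) z := by
  obtain ⟨k, hk, hkz⟩ := exists_lt_aperture hz
  have hn := norm_pos_iff.2 (ne_zero_of_mem_slit hz)
  -- The derivative `t² / (1 - w t²)²` is bounded uniformly in `t` when `w` stays in a sector and
  -- away from `0`; with `‖w‖ > ‖z‖ / 2` the bound depends only on `k` and `‖z‖`.
  set s : Set ℂ := {w | k * ‖w‖ < aperture w} ∩ {w | ‖z‖ / 2 < ‖w‖} with hs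
  have hsopen : IsOpen s := (isOpen_lt (by fun_prop) continuous_aperture).inter
    (isOpen_lt (by fun_prop) (by fun_prop))
  have hzs : z ∈ s := ⟨hkz, by simp only [Set.mem_ofPred_eq]; linarith⟩
  have hslit : ∀ w ∈ s, w ∈ slit := fun w hw =>
    mem_slit_iff.2 ((mul_nonneg hk.le (norm_nonneg w)).trans_lt hw.1)
  have hder : ∀ w ∈ s, ∀ t : ℝ, HasDerivAt
      (fun w : ℂ => w * ((t ^ 2 : ℝ) : ℂ) / (1 - w * ((t ^ 2 : ℝ) : ℂ)))
      (((t ^ 2 : ℝ) : ℂ) / (1 - w * ((t ^ 2 : ℝ) : ℂ)) ^ 2) w := by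
    intro w hw t
    have hne := one_sub_mul_ne_zero (hslit w hw) (sq_nonneg t)
    have h1 : HasDerivAt (fun w : ℂ => w * ((t ^ 2 : ℝ) : ℂ)) ((t ^ 2 : ℝ) : ℂ) w := by
      have := (hasDerivAt_id' w).mul_const ((t ^ 2 : ℝ) : ℂ)
      rwa [one_mul] at this
    have h2 := h1.div (h1.const_sub 1) hne
    have h3 := h2.congr_deriv (g' := ((t ^ 2 : ℝ) : ℂ) / (1 - w * ((t ^ 2 : ℝ) : ℂ)) ^ 2) (by ring)
    exact h3
  refine (hasDerivAt_integral_of_dominated_loc_of_deriv_le (hsopen.mem_nhds hzs)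
    (bound := fun _ => 8 / (k ^ 2 * ‖z‖)) ?_ (integrable_psi_integrand μ hz) ?_ ?_
    (integrable_const _) (Eventually.of_forall fun t w hw => hder w hw t)).2.differentiableAt
  · filter_upwards [hsopen.mem_nhds hzs] with w hw
    exact (continuous_psi_integrand (hslit w hw)).aestronglyMeasurable
  · refine Continuous.aestronglyMeasurable ?_
    refine Continuous.div (Complex.continuous_ofReal.comp (by fun_prop)) ?_
      fun t => pow_ne_zero _ (one_sub_mul_ne_zero hz (sq_nonneg t))
    exact (continuous_const.sub
      (continuous_const.mul (Complex.continuous_ofReal.comp (by fun_prop)))).pow 2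
  · refine Eventually.of_forall fun t w hw => ?_
    have h := le_norm_one_sub_mul hk hw.1 (t ^ 2)
    have hw2 : ‖z‖ / 2 < ‖w‖ := hw.2
    have ht := sq_nonneg t
    have hpos : 0 < k / 2 * (1 + ‖w‖ * t ^ 2) := by positivity
    rw [norm_div, norm_pow, Complex.norm_real, Real.norm_of_nonneg ht,
      div_le_div_iff₀ (pow_pos (hpos.trans_le h) 2) (by positivity)]
    have h3 : (k / 2 * (1 + ‖w‖ * t ^ 2)) ^ 2 ≤ ‖1 - w * ((t ^ 2 : ℝ) : ℂ)‖ ^ 2 := by gcongr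
    have h4 : 1 + ‖z‖ * t ^ 2 ≤ (1 + ‖w‖ * t ^ 2) ^ 2 := by
      nlinarith [mul_nonneg ht (by linarith : 0 ≤ ‖w‖ - ‖z‖ / 2), sq_nonneg (‖w‖ * t ^ 2)]
    have h5 : 0 < k ^ 2 := by positivity
    nlinarith [mul_le_mul_of_nonneg_left h4 h5.le, mul_nonneg h5.le (mul_nonneg hn.le ht)]

/-! ### Inverting functions tangent to the identity in sectors -/

/-- `aperture` is 2-Lipschitz and at most `2 ‖z‖`. Balls of radius `aperture z / 8` are therefore
the natural neighbourhoods: they have size proportional to `‖z‖` in a sector and stay inside the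
sector with `k` halved. -/
theorem mem_closedBall_aperture {z w : ℂ} (hw : w ∈ Metric.closedBall z (aperture z / 8)) :
    3 / 4 * aperture z ≤ aperture w ∧ ‖w‖ ≤ 5 / 4 * ‖z‖ := by
  rw [mem_closedBall_iff_norm] at hw
  have h1 := aperture_sub_le z w
  have h2 := norm_sub_norm_le w z
  have h3 := aperture_le z
  rw [norm_sub_rev] at h1
  constructor <;> linarith

theorem lt_aperture_of_mem_closedBall {k : ℝ} (hk : 0 < k) {z w : ℂ} (hz : k * ‖z‖ < aperture z)
    (hw : w ∈ Metric.closedBall z (aperture z / 8)) : k / 2 * ‖w‖ < aperture w := by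
  obtain ⟨h1, h2⟩ := mem_closedBall_aperture hw
  have := mul_le_mul_of_nonneg_left h2 (half_pos hk).le
  have h3 : 0 ≤ k * ‖z‖ := by positivity
  linarith

theorem mem_slit_of_lt_aperture {k : ℝ} (hk : 0 < k) {z : ℂ} (hz : k * ‖z‖ < aperture z) :
    z ∈ slit := mem_slit_iff.2 ((mul_nonneg hk.le (norm_nonneg z)).trans_lt hz)

/-- The functions in `𝓗` are differentiable off `[0, ∞)` and `H z / z → 1` at `0` in sectors,
uniformly in `H ∈ 𝓗`. -/
structure TangentToId (𝓗 : Set (ℂ → ℂ)) : Prop where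
  differentiableAt : ∀ H ∈ 𝓗, ∀ z ∈ slit, DifferentiableAt ℂ H z
  norm_sub_le : ∀ k : ℝ, 0 < k → ∀ ε : ℝ, 0 < ε → ∃ β : ℝ, 0 < β ∧ ∀ H ∈ 𝓗, ∀ z : ℂ,
    k * ‖z‖ < aperture z → ‖z‖ < β → ‖H z - z‖ ≤ ε * ‖z‖

/-- Cauchy's estimate on the circle of radius `aperture z / 8 > k ‖z‖ / 8`. The points of the circle
have norm at most `5 / 4 * ‖z‖`, so the tolerance `ε * k / 10` gives exactly `ε`. -/
theorem TangentToId.norm_deriv_sub_le {𝓗 : Set (ℂ → ℂ)} (h : TangentToId 𝓗) {k : ℝ}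
    (hk : 0 < k) {ε : ℝ} (hε : 0 < ε) : ∃ β : ℝ, 0 < β ∧ ∀ H ∈ 𝓗, ∀ z : ℂ,
      k * ‖z‖ < aperture z → ‖z‖ < β → ‖deriv (fun u => H u - u) z‖ ≤ ε := by
  obtain ⟨β, hβ, hb⟩ := h.norm_sub_le (k / 2) (half_pos hk) (ε * k / 10) (by positivity)
  refine ⟨β / 2, half_pos hβ, fun H hH z hz hzβ => ?_⟩
  have hzs := mem_slit_of_lt_aperture hk hz
  have ha := mem_slit_iff.1 hzs
  have hball : ∀ w ∈ Metric.closedBall z (aperture z / 8), w ∈ slit := fun w hw =>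
    mem_slit_of_lt_aperture (half_pos hk) (lt_aperture_of_mem_closedBall hk hz hw)
  have hn := norm_pos_iff.2 (ne_zero_of_mem_slit hzs)
  have hd : DifferentiableOn ℂ (fun u => H u - u) (Metric.closedBall z (aperture z / 8)) :=
    fun w hw => ((h.differentiableAt H hH w (hball w hw)).sub
      differentiableAt_id).differentiableWithinAt
  have hcl : DiffContOnCl ℂ (fun u => H u - u) (Metric.ball z (aperture z / 8)) :=
    DifferentiableOn.diffContOnCl (hd.mono Metric.closure_ball_subset_closedBall)
  refine (Complex.norm_deriv_le_of_forall_mem_sphere_norm_le (by positivity) hcl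
    (C := ε * k / 10 * (5 / 4 * ‖z‖)) fun w hw => ?_).trans ?_
  · have hw' := Metric.sphere_subset_closedBall hw
    have h2 := (mem_closedBall_aperture hw').2
    refine (hb H hH w (lt_aperture_of_mem_closedBall hk hz hw') (by linarith)).trans ?_
    gcongr
  · rw [div_le_iff₀ (by positivity)]
    nlinarith

theorem TangentToId.exists_contracting {𝓗 : Set (ℂ → ℂ)} (h : TangentToId 𝓗) {k : ℝ}
    (hk : 0 < k) : ∃ β : ℝ, 0 < β ∧ ∀ H ∈ 𝓗, ∀ z : ℂ, k * ‖z‖ < aperture z → ‖z‖ < β →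
      ∀ u ∈ Metric.closedBall z (aperture z / 8), ∀ v ∈ Metric.closedBall z (aperture z / 8),
        ‖(H v - v) - (H u - u)‖ ≤ 1 / 2 * ‖v - u‖ := by
  obtain ⟨β, hβ, hb⟩ := h.norm_deriv_sub_le (half_pos hk) (ε := 1 / 2) (by norm_num)
  refine ⟨β / 2, half_pos hβ, fun H hH z hz hzβ u hu v hv => ?_⟩
  refine (convex_closedBall z (aperture z / 8)).norm_image_sub_le_of_norm_deriv_le
    (f := fun u => H u - u) (fun w hw => ?_) (fun w hw => ?_) hu hv
  · exact (h.differentiableAt H hH w (mem_slit_of_lt_aperture (half_pos hk)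
      (lt_aperture_of_mem_closedBall hk hz hw))).sub differentiableAt_id
  · refine hb H hH w (lt_aperture_of_mem_closedBall hk hz hw) ?_
    have := (mem_closedBall_aperture hw).2
    linarith [norm_nonneg z]

open Classical in
/-- The solution `u` of `H u = z` close to `z`. -/
def localInv (H : ℂ → ℂ) (z : ℂ) : ℂ :=
  if h : ∃ u ∈ Metric.closedBall z (aperture z / 8), H u = z then h.choose else z

/-- `localInv H` is near `z` a good inverse of `H`. -/
structure InvertsAt (H : ℂ → ℂ) (ε : ℝ) (z : ℂ) : Prop where
  mem_ball : localInv H z ∈ Metric.closedBall z (aperture z / 8)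
  right_inv : H (localInv H z) = z
  left_inv : localInv H (H z) = z
  norm_sub_le : ‖localInv H z - z‖ ≤ ε * ‖z‖
  expanding : ∀ u ∈ Metric.closedBall z (aperture z / 8),
    ∀ v ∈ Metric.closedBall z (aperture z / 8), ‖u - v‖ ≤ 2 * ‖H u - H v‖

/-- If `H - id` contracts by `1 / 2`, then `H` shrinks distances by at most a factor `2`. This one
inequality supplies injectivity, continuity of the inverse, and later its stability under perturbing
`H`. -/
theorem norm_sub_le_of_contracting {H : ℂ → ℂ} {u v : ℂ}
    (h : ‖(H u - u) - (H v - v)‖ ≤ 1 / 2 * ‖u - v‖) : ‖u - v‖ ≤ 2 * ‖H u - H v‖ := by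
  have h1 : u - v = (H u - H v) - ((H u - u) - (H v - v)) := by ring
  have h2 := norm_sub_le (H u - H v) ((H u - u) - (H v - v))
  rw [← h1] at h2
  linarith

/-- A solution of `H u = z` is a fixed point of `u ↦ z - (H u - u)`, a contraction of the ball about
`z`. -/
theorem TangentToId.exists_localInv {𝓗 : Set (ℂ → ℂ)} (h : TangentToId 𝓗) {k : ℝ}
    (hk : 0 < k) {ε : ℝ} (hε : 0 < ε) : ∃ β : ℝ, 0 < β ∧ ∀ H ∈ 𝓗, ∀ z : ℂ,
      k * ‖z‖ < aperture z → ‖z‖ < β →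
      localInv H z ∈ Metric.closedBall z (aperture z / 8) ∧ H (localInv H z) = z ∧
      ‖localInv H z - z‖ ≤ ε * ‖z‖ := by
  obtain ⟨β₁, hβ₁, hb₁⟩ := h.exists_contracting hk
  -- The factor `4 / 5` absorbs `‖u‖ ≤ 5 / 4 * ‖z‖`; the bound `k / 8` keeps the iteration inside
  -- the ball, and `ε` gives the final estimate.
  obtain ⟨β₂, hβ₂, hb₂⟩ := h.norm_sub_le (k / 2) (half_pos hk) (min ε (k / 8) * (4 / 5))
    (by positivity)
  refine ⟨min β₁ (β₂ / 2), by positivity, fun H hH z hz hzβ => ?_⟩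
  have hz1 : ‖z‖ < β₁ := hzβ.trans_le (min_le_left _ _)
  have hz2 : ‖z‖ < β₂ / 2 := hzβ.trans_le (min_le_right _ _)
  set B := Metric.closedBall z (aperture z / 8) with hB
  have hsmall : ∀ u ∈ B, ‖H u - u‖ ≤ min ε (k / 8) * ‖z‖ := by
    intro u hu
    have h2 := (mem_closedBall_aperture hu).2
    refine (hb₂ H hH u (lt_aperture_of_mem_closedBall hk hz hu)
      (by linarith [norm_nonneg z])).trans ?_
    have h0 : 0 < min ε (k / 8) := by positivity
    nlinarith
  have hradius : min ε (k / 8) * ‖z‖ ≤ aperture z / 8 := by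
    have := mul_le_mul_of_nonneg_right (min_le_right ε (k / 8)) (norm_nonneg z)
    linarith
  have hmaps : MapsTo (fun u => z - (H u - u)) B B := by
    intro u hu
    rw [hB, mem_closedBall_iff_norm]
    have : z - (H u - u) - z = -(H u - u) := by ring
    rw [this, norm_neg]
    exact (hsmall u hu).trans hradius
  have hcontr : ContractingWith (1 / 2) (hmaps.restrict (fun u => z - (H u - u)) B B) := by
    refine ⟨by rw [← NNReal.coe_lt_coe]; norm_num, LipschitzWith.of_dist_le_mul ?_⟩
    rintro ⟨u, hu⟩ ⟨v, hv⟩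
    have h1 := hb₁ H hH z hz hz1 u hu v hv
    rw [Subtype.dist_eq, Subtype.dist_eq, dist_eq_norm, dist_eq_norm]
    have h2 : z - (H u - u) - (z - (H v - v)) = (H v - v) - (H u - u) := by ring
    simp only [MapsTo.val_restrict_apply]
    rw [h2, norm_sub_rev u v]
    simpa using h1
  have hzB : z ∈ B := Metric.mem_closedBall_self (by
    have := aperture_nonneg z; positivity)
  obtain ⟨y, hyB, hy, -⟩ := hcontr.exists_fixedPoint' Metric.isClosed_closedBall.isComplete hmaps
    hzB (edist_ne_top _ _)
  have hyz : H y = z := by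
    have : z - (H y - y) = y := hy
    linear_combination -this
  have hex : ∃ u ∈ B, H u = z := ⟨y, hyB, hyz⟩
  have hF : localInv H z = hex.choose := dif_pos hex
  obtain ⟨h1, h2⟩ := hex.choose_spec
  rw [← hF] at h1 h2
  refine ⟨h1, h2, ?_⟩
  have h3 := hsmall _ h1
  rw [h2, norm_sub_rev] at h3
  exact h3.trans (mul_le_mul_of_nonneg_right (min_le_left _ _) (norm_nonneg z))

/-- For the left inverse, `z` and `localInv H (H z)` are two preimages of `H z` in the ball about `H
z`, where `H` is injective. Since `H z` may leave the sector of `z`, everything is prepared for `k /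
2`. -/
theorem TangentToId.exists_invertsAt {𝓗 : Set (ℂ → ℂ)} (h : TangentToId 𝓗) {k : ℝ}
    (hk : 0 < k) {ε : ℝ} (hε : 0 < ε) : ∃ β : ℝ, 0 < β ∧ ∀ H ∈ 𝓗, ∀ z : ℂ,
      k * ‖z‖ < aperture z → ‖z‖ < β → InvertsAt H ε z := by
  obtain ⟨β₁, hβ₁, hb₁⟩ := h.exists_contracting (half_pos hk)
  obtain ⟨β₂, hβ₂, hb₂⟩ := h.exists_localInv (half_pos hk) hε
  obtain ⟨β₃, hβ₃, hb₃⟩ := h.norm_sub_le k hk (k / 16) (by positivity)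
  refine ⟨min (min (β₁ / 2) (β₂ / 2)) β₃, by positivity, fun H hH z hz hzβ => ?_⟩
  have hz1 : ‖z‖ < β₁ / 2 := hzβ.trans_le ((min_le_left _ _).trans (min_le_left _ _))
  have hz2 : ‖z‖ < β₂ / 2 := hzβ.trans_le ((min_le_left _ _).trans (min_le_right _ _))
  have hz3 : ‖z‖ < β₃ := hzβ.trans_le (min_le_right _ _)
  have hn0 := norm_nonneg z
  have hz' : k / 2 * ‖z‖ < aperture z := by
    have : 0 ≤ k * ‖z‖ := by positivity
    linarith
  obtain ⟨h1, h2, h3⟩ := hb₂ H hH z hz' (by linarith)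
  refine ⟨h1, h2, ?_, h3, fun u hu v hv =>
    norm_sub_le_of_contracting (hb₁ H hH z hz' (by linarith) v hv u hu)⟩
  have h4 := hb₃ H hH z hz hz3
  have hball : H z ∈ Metric.closedBall z (aperture z / 8) := by
    rw [mem_closedBall_iff_norm]
    have : 0 ≤ k * ‖z‖ := by positivity
    linarith
  obtain ⟨h5, h6⟩ := mem_closedBall_aperture hball
  have h7 := lt_aperture_of_mem_closedBall hk hz hball
  obtain ⟨h8, h9, -⟩ := hb₂ H hH (H z) h7 (by linarith)
  have hzball : z ∈ Metric.closedBall (H z) (aperture (H z) / 8) := by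
    rw [mem_closedBall_iff_norm, norm_sub_rev]
    linarith
  have h10 := norm_sub_le_of_contracting
    (hb₁ H hH (H z) h7 (by linarith) z hzball _ h8)
  rw [h9, sub_self, norm_zero, mul_zero] at h10
  exact sub_eq_zero.1 (norm_le_zero_iff.1 h10)

/-- The inverse is picked by choice separately at each point, so its continuity must be proved: it
follows from the expansion inequality. Differentiability then follows because `H'` is within `1 / 2`
of `1`. -/
theorem TangentToId.exists_differentiableAt_localInv {𝓗 : Set (ℂ → ℂ)} (h : TangentToId 𝓗)
    {k : ℝ} (hk : 0 < k) : ∃ β : ℝ, 0 < β ∧ ∀ H ∈ 𝓗, ∀ z : ℂ,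
      k * ‖z‖ < aperture z → ‖z‖ < β → DifferentiableAt ℂ (localInv H) z := by
  obtain ⟨β₁, hβ₁, hb₁⟩ := h.exists_invertsAt hk (ε := k / 16) (by positivity)
  obtain ⟨β₂, hβ₂, hb₂⟩ := h.norm_deriv_sub_le (half_pos hk) (ε := 1 / 2) (by norm_num)
  refine ⟨min β₁ (β₂ / 2), by positivity, fun H hH z hz hzβ => ?_⟩
  have hz1 : ‖z‖ < β₁ := hzβ.trans_le (min_le_left _ _)
  have hz2 : ‖z‖ < β₂ / 2 := hzβ.trans_le (min_le_right _ _)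
  have hinv := hb₁ H hH z hz hz1
  have hFslit : localInv H z ∈ slit := mem_slit_of_lt_aperture (half_pos hk)
    (lt_aperture_of_mem_closedBall hk hz hinv.mem_ball)
  have hev : ∀ᶠ w in 𝓝 z, k * ‖w‖ < aperture w ∧ ‖w‖ < β₁ :=
    ((continuous_const.mul continuous_norm).continuousAt.eventually_lt
      continuous_aperture.continuousAt hz).and
      (continuous_norm.continuousAt.eventually_lt_const hz1)
  have hcont : ContinuousAt (localInv H) z := by
    rw [ContinuousAt, tendsto_iff_norm_sub_tendsto_zero]
    have hlim : Tendsto (fun w => 2 * ‖w - z‖) (𝓝 z) (𝓝 0) := by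
      have : Continuous fun w : ℂ => 2 * ‖w - z‖ := by fun_prop
      simpa using this.tendsto z
    refine squeeze_zero' (Eventually.of_forall fun w => norm_nonneg _) ?_ hlim
    -- The value at `w` is only known to lie in the ball about `w`; this puts it in the ball about
    -- `z`, where uniqueness is available.
    have hd : ∀ᶠ w in 𝓝 z, k / 16 * ‖w‖ + ‖w - z‖ < aperture z / 8 := by
      have : Continuous fun w : ℂ => k / 16 * ‖w‖ + ‖w - z‖ := by fun_prop
      refine this.continuousAt.eventually_lt_const ?_
      have : 0 ≤ k * ‖z‖ := by positivity
      simp only [sub_self, norm_zero, add_zero]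
      linarith
    filter_upwards [hev, hd] with w hw hwd
    have hw' := hb₁ H hH w hw.1 hw.2
    have h1 : localInv H w ∈ Metric.closedBall z (aperture z / 8) := by
      rw [mem_closedBall_iff_norm]
      have := norm_sub_le_norm_sub_add_norm_sub (localInv H w) w z
      linarith [hw'.norm_sub_le]
    have h2 := hinv.expanding _ h1 _ hinv.mem_ball
    rwa [hw'.right_inv, hinv.right_inv] at h2
  have hdH := h.differentiableAt H hH _ hFslit
  have hd := hb₂ H hH _ (lt_aperture_of_mem_closedBall hk hz hinv.mem_ball) (by
    have := (mem_closedBall_aperture hinv.mem_ball).2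
    linarith [norm_nonneg z])
  have hd' : deriv (fun u => H u - u) (localInv H z) = deriv H (localInv H z) - 1 := by
    rw [deriv_fun_sub hdH differentiableAt_fun_id, deriv_id'']
  have hne : deriv H (localInv H z) ≠ 0 := by
    intro h0
    rw [hd', h0] at hd
    norm_num at hd
  refine (HasDerivAt.of_local_left_inverse hcont hdH.hasDerivAt hne ?_).differentiableAt
  filter_upwards [hev] with w hw
  exact (hb₁ H hH w hw.1 hw.2).right_inv

theorem TangentToId.isSectorInverse {H : ℂ → ℂ} (h : TangentToId {H}) :
    IsSectorInverse H (localInv H) := by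
  intro α h0 hπ
  have hk := one_add_cos_pos h0 hπ
  refine ⟨?_, ?_, ?_⟩
  · obtain ⟨β, hβ, hb⟩ := h.exists_differentiableAt_localInv hk
    refine ⟨β, hβ, DifferentiableOn.analyticOnNhd (fun z hz => ?_) (isOpen_Delta h0 hπ)⟩
    rw [mem_Delta_iff h0 hπ] at hz
    exact (hb H rfl z hz.1 hz.2).differentiableWithinAt
  · rw [Metric.tendsto_nhds]
    intro ε hε
    obtain ⟨β, hβ, hb⟩ := h.exists_invertsAt hk (half_pos hε)
    have hz : ∀ᶠ z in 𝓝[sector α] (0 : ℂ), ‖z‖ < β :=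
      nhdsWithin_le_nhds
        (continuous_norm.continuousAt.eventually_lt_const (by simpa using hβ))
    filter_upwards [hz, self_mem_nhdsWithin] with z hzβ hzs
    have h1 := (hb H rfl z ((mem_sector_iff h0 hπ).1 hzs) hzβ).norm_sub_le
    have hz0 : z ≠ 0 := hzs.1
    have h2 : localInv H z / z - 1 = (localInv H z - z) / z := by field_simp
    rw [dist_eq_norm, h2, norm_div, div_lt_iff₀ (norm_pos_iff.2 hz0)]
    nlinarith [norm_pos_iff.2 hz0]
  · obtain ⟨β, hβ, hb⟩ := h.exists_invertsAt hk one_pos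
    refine ⟨β, hβ, fun z hz => ?_⟩
    rw [mem_Delta_iff h0 hπ] at hz
    have := hb H rfl z hz.1 hz.2
    exact ⟨this.right_inv, this.left_inv⟩

theorem TangentToId.mono {𝓗 𝓗' : Set (ℂ → ℂ)} (h : TangentToId 𝓗) (hsub : 𝓗' ⊆ 𝓗) :
    TangentToId 𝓗' := by
  refine ⟨fun H hH => h.differentiableAt H (hsub hH), fun k hk ε hε => ?_⟩
  obtain ⟨β, hβ, hb⟩ := h.norm_sub_le k hk ε hε
  exact ⟨β, hβ, fun H hH => hb H (hsub hH)⟩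

/-! ### The rectangular Cauchy transform in terms of `ψ_μ` -/

/-- The polynomial `T(x) = (x + 1)(lam x + 1)`. -/
def rectT (lam : ℝ) (x : ℂ) : ℂ := (x + 1) * (lam * x + 1)

theorem cpow_half_sq (x : ℂ) : (x ^ (1 / 2 : ℂ)) ^ 2 = x := by
  rw [one_div]
  exact Complex.cpow_nat_inv_pow x two_ne_zero

theorem sqrtNeg_sq (z : ℂ) : sqrtNeg z ^ 2 = z := by
  rw [sqrtNeg, mul_pow, cpow_half_sq, Complex.I_sq]
  ring

theorem IsSymmetric.integral_comp_neg {μ : Measure ℝ} (hμ : IsSymmetric μ) (f : ℝ → ℂ) :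
    ∫ t, f (-t) ∂μ = ∫ t, f t ∂μ := by
  conv_rhs => rw [← hμ]
  exact ((MeasurableEquiv.neg ℝ).measurableEmbedding.integral_map f).symm

/-- With `w = √z`, the kernels at `t` and `-t` add up to `2w / (1 - z t²)`, and `1 / (1 - z t²)` is
`1` plus the kernel of `ψ`. -/
theorem cauchyTransform_one_div_sqrtNeg {μ : Measure ℝ} [IsProbabilityMeasure μ]
    (hμ : IsSymmetric μ) {z : ℂ} (hz : z ∈ slit) :
    cauchyTransform μ (1 / sqrtNeg z) = sqrtNeg z * (1 + psi μ z) := by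
  set w := sqrtNeg z with hw
  have hw2 : w ^ 2 = z := sqrtNeg_sq z
  have hw0 : w ≠ 0 := by
    intro h
    rw [h] at hw2
    exact ne_zero_of_mem_slit hz (by rw [← hw2]; simp)
  have hne : ∀ t : ℝ, 1 - z * ((t ^ 2 : ℝ) : ℂ) ≠ 0 := fun t => one_sub_mul_ne_zero hz (sq_nonneg t)
  have hfac : ∀ t : ℝ, (1 - w * t) * (1 + w * t) = 1 - z * ((t ^ 2 : ℝ) : ℂ) := by
    intro t
    rw [← hw2]; push_cast; ring
  have hne1 : ∀ t : ℝ, 1 - w * (t : ℂ) ≠ 0 := fun t h => hne t (by rw [← hfac, h, zero_mul])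
  have hne2 : ∀ t : ℝ, 1 + w * (t : ℂ) ≠ 0 := fun t h => hne t (by rw [← hfac, h, mul_zero])
  have hne3 : ∀ t : ℝ, 1 / w - (t : ℂ) ≠ 0 := by
    intro t h
    apply hne1 t
    have : w * (1 / w - (t : ℂ)) = 1 - w * t := by field_simp
    rw [← this, h, mul_zero]
  -- A real value of `1 / w` would be a pole of the kernel at some real `t`.
  have him : (1 / w).im ≠ 0 := by
    intro h
    exact hne3 (1 / w).re (Complex.ext (by simp) (by simpa using h))
  have hint : Integrable (fun t : ℝ => 1 / (1 / w - (t : ℂ))) μ := by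
    refine Integrable.of_bound (Continuous.aestronglyMeasurable ?_) (1 / |(1 / w).im|)
      (Eventually.of_forall fun t => ?_)
    · exact Continuous.div continuous_const (by fun_prop) hne3
    · rw [norm_div, norm_one]
      have h1 : |(1 / w - (t : ℂ)).im| ≤ ‖1 / w - (t : ℂ)‖ := Complex.abs_im_le_norm _
      rw [Complex.sub_im, Complex.ofReal_im, sub_zero] at h1
      exact one_div_le_one_div_of_le (abs_pos.2 him) h1
  have hint' : Integrable (fun t : ℝ => 1 / (1 / w - ((-t : ℝ) : ℂ))) μ := by
    have h1 : Integrable (fun t : ℝ => 1 / (1 / w - (t : ℂ))) (μ.map (fun t : ℝ => -t)) := by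
      rw [hμ]; exact hint
    exact ((MeasurableEquiv.neg ℝ).measurableEmbedding.integrable_map_iff).1 h1
  have hsum : 2 * cauchyTransform μ (1 / w) =
      ∫ t : ℝ, (1 / (1 / w - (t : ℂ)) + 1 / (1 / w - ((-t : ℝ) : ℂ))) ∂μ := by
    rw [integral_add hint hint',
      hμ.integral_comp_neg (fun t : ℝ => 1 / (1 / w - (t : ℂ))), cauchyTransform]
    ring
  have hpt : ∀ t : ℝ, 1 / (1 / w - (t : ℂ)) + 1 / (1 / w - ((-t : ℝ) : ℂ)) =
      2 * w * (1 + z * ((t ^ 2 : ℝ) : ℂ) / (1 - z * ((t ^ 2 : ℝ) : ℂ))) := by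
    intro t
    have e1 : 1 / (1 / w - (t : ℂ)) = w / (1 - w * t) := by
      rw [div_eq_div_iff (hne3 t) (hne1 t)]
      field_simp
    have e2 : 1 / (1 / w - ((-t : ℝ) : ℂ)) = w / (1 + w * t) := by
      rw [div_eq_div_iff (hne3 (-t)) (hne2 t)]
      push_cast
      field_simp
      ring
    have e3 : 1 + z * ((t ^ 2 : ℝ) : ℂ) / (1 - z * ((t ^ 2 : ℝ) : ℂ)) =
        1 / ((1 - w * t) * (1 + w * t)) := by
      rw [hfac, eq_div_iff (hne t), add_mul, div_mul_cancel₀ _ (hne t)]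
      ring
    rw [e1, e2, e3]
    have := hne1 t
    have := hne2 t
    field_simp
    ring
  simp_rw [hpt] at hsum
  rw [integral_const_mul, integral_add (integrable_const _) (integrable_psi_integrand μ hz)] at hsum
  have h1 : ∫ _ : ℝ, (1 : ℂ) ∂μ = 1 := by simp
  rw [h1] at hsum
  have h2 : (2 : ℂ) ≠ 0 := two_ne_zero
  apply mul_left_cancel₀ h2
  rw [hsum, psi]
  ring

theorem rectCauchy_eq {lam : ℝ} {μ : Measure ℝ} [IsProbabilityMeasure μ] (hμ : IsSymmetric μ)
    {z : ℂ} (hz : z ∈ slit) : rectCauchy lam μ z = z * rectT lam (psi μ z) := by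
  rw [rectCauchy, cauchyTransform_one_div_sqrtNeg hμ hz, rectT]
  have := sqrtNeg_sq z
  linear_combination ((lam : ℂ) * (1 + psi μ z) ^ 2 + (1 - (lam : ℂ)) * (1 + psi μ z)) * this

/-! ### The functions `T` and `U` -/

/-- Only the square of the root enters, so no restriction on `y` is needed; the branch matters only
for `rectU_zero` and differentiability. -/
theorem rectT_rectU (lam : ℝ) (y : ℂ) : rectT lam (rectU lam y) = 1 + y := by
  unfold rectT rectU
  split_ifs with h
  · simp [h, add_comm]
  · have hl : (lam : ℂ) ≠ 0 := by exact_mod_cast h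
    have hs := cpow_half_sq (((lam : ℂ) + 1) ^ 2 + 4 * (lam : ℂ) * y)
    set s := (((lam : ℂ) + 1) ^ 2 + 4 * (lam : ℂ) * y) ^ (1 / 2 : ℂ)
    field_simp
    linear_combination hs

/-- `T(a) - T(b) = (a - b) (lam (a + b) + lam + 1)`, and the second factor cannot vanish when `‖a +
b‖ < 1`. -/
theorem rectT_injective {lam : ℝ} (h0 : 0 ≤ lam) {a b : ℂ} (ha : ‖a‖ < 1 / 2)
    (hb : ‖b‖ < 1 / 2) (h : rectT lam a = rectT lam b) : a = b := by
  have hfac : (a - b) * (lam * (a + b) + lam + 1) = 0 := by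
    unfold rectT at h
    linear_combination h
  rcases mul_eq_zero.1 hfac with h2 | h2
  · exact sub_eq_zero.1 h2
  · exfalso
    have h3 : ((lam + 1 : ℝ) : ℂ) = -(lam * (a + b)) := by
      push_cast
      linear_combination h2
    have h4 := congrArg norm h3
    rw [norm_neg, norm_mul, Complex.norm_real, Complex.norm_real, Real.norm_of_nonneg h0,
      Real.norm_of_nonneg (by linarith)] at h4
    have h5 := norm_add_le a b
    nlinarith

theorem norm_rectT_sub_one_le {lam : ℝ} (h0 : 0 ≤ lam) (h1 : lam ≤ 1) {x : ℂ} (hx : ‖x‖ ≤ 1) :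
    ‖rectT lam x - 1‖ ≤ 3 * ‖x‖ := by
  have h : rectT lam x - 1 = x * (((lam + 1 : ℝ) : ℂ) + lam * x) := by
    unfold rectT; push_cast; ring
  rw [h, norm_mul, mul_comm]
  refine mul_le_mul_of_nonneg_right ?_ (norm_nonneg x)
  refine (norm_add_le _ _).trans ?_
  rw [norm_mul, Complex.norm_real, Complex.norm_real, Real.norm_of_nonneg h0,
    Real.norm_of_nonneg (by linarith)]
  nlinarith [norm_nonneg x]

theorem differentiableAt_rectT (lam : ℝ) (x : ℂ) : DifferentiableAt ℂ (rectT lam) x := by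
  unfold rectT; fun_prop

theorem differentiableAt_rectU {lam : ℝ} (h0 : 0 ≤ lam) {y : ℂ}
    (hy : ‖y‖ < 1 / 4) : DifferentiableAt ℂ (rectU lam) y := by
  by_cases h : lam = 0
  · have : rectU lam = fun y => y := by ext y; simp [rectU, h]
    rw [this]; exact differentiableAt_fun_id
  · have : rectU lam = fun y : ℂ =>
        (-(lam : ℂ) - 1 + (((lam : ℂ) + 1) ^ 2 + 4 * (lam : ℂ) * y) ^ (1 / 2 : ℂ)) /
          (2 * (lam : ℂ)) := by
      ext y; simp [rectU, h]
    rw [this]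
    have hs : ((lam : ℂ) + 1) ^ 2 + 4 * (lam : ℂ) * y ∈ Complex.slitPlane := by
      rw [Complex.mem_slitPlane_iff]
      left
      have h2 : (((lam : ℂ) + 1) ^ 2 + 4 * (lam : ℂ) * y).re = (lam + 1) ^ 2 + 4 * lam * y.re := by
        have : ((lam : ℂ) + 1) ^ 2 + 4 * (lam : ℂ) * y =
            (((lam + 1) ^ 2 : ℝ) : ℂ) + ((4 * lam : ℝ) : ℂ) * y := by push_cast; ring
        rw [this, Complex.add_re, Complex.re_ofReal_mul, Complex.ofReal_re]
      rw [h2]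
      have h3 := (abs_le.1 (Complex.abs_re_le_norm y)).1
      nlinarith
    refine DifferentiableAt.div_const ?_ _
    refine DifferentiableAt.const_add _ ?_
    exact DifferentiableAt.cpow (by fun_prop) (by fun_prop) hs

theorem rectU_zero {lam : ℝ} (h0 : 0 ≤ lam) : rectU lam 0 = 0 := by
  unfold rectU
  split_ifs with h
  · rfl
  · have h2 : (((lam : ℂ) + 1) ^ 2 + 4 * (lam : ℂ) * 0) ^ (1 / 2 : ℂ) = (lam : ℂ) + 1 := by
      have h3 : ((lam : ℂ) + 1) ^ 2 + 4 * (lam : ℂ) * 0 = (((lam + 1) ^ 2 : ℝ) : ℂ) := by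
        push_cast; ring
      have h4 : (1 / 2 : ℂ) = ((1 / 2 : ℝ) : ℂ) := by push_cast; ring
      rw [h3, h4, ← Complex.ofReal_cpow (by positivity), ← Real.sqrt_eq_rpow,
        Real.sqrt_sq (by linarith)]
      push_cast; ring
    rw [h2]
    simp

theorem exists_norm_rectU_lt {lam : ℝ} (h0 : 0 ≤ lam) {ε : ℝ} (hε : 0 < ε) :
    ∃ η : ℝ, 0 < η ∧ ∀ y : ℂ, ‖y‖ < η → ‖rectU lam y‖ < ε := by
  have hc : ContinuousAt (rectU lam) 0 :=
    (differentiableAt_rectU h0 (by norm_num)).continuousAt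
  obtain ⟨η, hη, h⟩ := Metric.continuousAt_iff.1 hc ε hε
  refine ⟨η, hη, fun y hy => ?_⟩
  have := h (x := y) (by simpa using hy)
  rwa [rectU_zero h0, dist_zero_right] at this

/-! ### The rectangular R-transforms of a tight family -/

/-- A tight family of symmetric probability measures. -/
structure TightSymmetric (𝓜 : Set (Measure ℝ)) : Prop where
  isProbabilityMeasure : ∀ μ ∈ 𝓜, IsProbabilityMeasure μ
  isSymmetric : ∀ μ ∈ 𝓜, IsSymmetric μ
  tail_lt : ∀ ε : ℝ, 0 < ε → ∃ s : ℝ, 0 < s ∧ ∀ μ ∈ 𝓜, tail μ s < ε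

/-- The bound by `tail μ ‖z‖` and monotonicity of `tail` turn smallness at a single `s` into
smallness for all `‖z‖ < s`. -/
theorem TightSymmetric.norm_psi_lt {𝓜 : Set (Measure ℝ)} (h : TightSymmetric 𝓜) {k : ℝ}
    (hk : 0 < k) {ε : ℝ} (hε : 0 < ε) : ∃ β : ℝ, 0 < β ∧ ∀ μ ∈ 𝓜, ∀ z : ℂ,
      k * ‖z‖ < aperture z → ‖z‖ < β → ‖psi μ z‖ < ε := by
  obtain ⟨s, hs, hb⟩ := h.tail_lt (ε * k / 2) (by positivity)
  refine ⟨s, hs, fun μ hμ z hz hzs => ?_⟩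
  have := h.isProbabilityMeasure μ hμ
  calc ‖psi μ z‖ ≤ 2 / k * tail μ ‖z‖ := norm_psi_le μ hk hz
    _ ≤ 2 / k * tail μ s := by
      gcongr
      exact tail_mono μ (norm_nonneg z) hzs.le
    _ < 2 / k * (ε * k / 2) := by
      gcongr
      exact hb μ hμ
    _ = ε := by field_simp

theorem differentiableAt_rectCauchy (lam : ℝ) {μ : Measure ℝ} [IsProbabilityMeasure μ]
    (hμ : IsSymmetric μ) {z : ℂ} (hz : z ∈ slit) : DifferentiableAt ℂ (rectCauchy lam μ) z := by
  have hd : DifferentiableAt ℂ (fun z => z * rectT lam (psi μ z)) z :=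
    differentiableAt_fun_id.mul
      ((differentiableAt_rectT lam _).comp z (differentiableAt_psi μ hz))
  refine hd.congr_of_eventuallyEq ?_
  filter_upwards [isOpen_slit.mem_nhds hz] with w hw
  exact rectCauchy_eq hμ hw

theorem TightSymmetric.tangentToId {lam : ℝ} (h0 : 0 ≤ lam) (h1 : lam ≤ 1) {𝓜 : Set (Measure ℝ)}
    (h : TightSymmetric 𝓜) : TangentToId (rectCauchy lam '' 𝓜) := by
  constructor
  · rintro _ ⟨μ, hμ, rfl⟩ z hz
    have := h.isProbabilityMeasure μ hμ
    exact differentiableAt_rectCauchy lam (h.isSymmetric μ hμ) hz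
  · intro k hk ε hε
    obtain ⟨β, hβ, hb⟩ := h.norm_psi_lt hk (ε := min 1 (ε / 3)) (by positivity)
    refine ⟨β, hβ, ?_⟩
    rintro _ ⟨μ, hμ, rfl⟩ z hz hzβ
    have := h.isProbabilityMeasure μ hμ
    have hψ := hb μ hμ z hz hzβ
    have h2 : rectCauchy lam μ z - z = z * (rectT lam (psi μ z) - 1) := by
      rw [rectCauchy_eq (h.isSymmetric μ hμ) (mem_slit_of_lt_aperture hk hz)]; ring
    rw [h2, norm_mul, mul_comm]
    refine mul_le_mul_of_nonneg_right ?_ (norm_nonneg z)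
    refine (norm_rectT_sub_one_le h0 h1 (hψ.le.trans (min_le_left _ _))).trans ?_
    have := hψ.le.trans (min_le_right _ _)
    linarith

/-- The function `U (z / H_μ⁻¹ z - 1)`. -/
def rGerm (lam : ℝ) (μ : Measure ℝ) (z : ℂ) : ℂ :=
  rectU lam (z / localInv (rectCauchy lam μ) z - 1)

theorem norm_div_sub_one_le {ε : ℝ} (hε : ε ≤ 1 / 2) {z w : ℂ} (hz : z ≠ 0)
    (h : ‖w - z‖ ≤ ε * ‖z‖) : w ≠ 0 ∧ ‖z / w - 1‖ ≤ 2 * ε := by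
  have hn := norm_pos_iff.2 hz
  have h1 : ‖z‖ ≤ ‖w‖ + ‖w - z‖ := by
    rw [norm_sub_rev]; simpa using norm_add_le w (z - w)
  have hw : 1 / 2 * ‖z‖ ≤ ‖w‖ := by nlinarith
  have hw0 : w ≠ 0 := by
    rintro rfl
    simp at hw; linarith
  refine ⟨hw0, ?_⟩
  have h2 : z / w - 1 = -(w - z) / w := by field_simp; ring
  have hε0 : 0 ≤ ε := by
    by_contra! hc
    nlinarith [norm_nonneg (w - z)]
  rw [h2, norm_div, norm_neg, div_le_iff₀ (norm_pos_iff.2 hw0)]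
  nlinarith

/-- The radius attached to each `α` does not depend on `μ`, so the union of the truncated sectors
over `α` serves the whole family. -/
theorem TightSymmetric.exists_isRTransformOn {lam : ℝ} (h0 : 0 ≤ lam) (h1 : lam ≤ 1)
    {𝓜 : Set (Measure ℝ)} (h : TightSymmetric 𝓜) :
    ∃ D : Set ℂ, (∀ α : ℝ, 0 < α → α < Real.pi → ∃ β : ℝ, 0 < β ∧ Delta α β ⊆ D) ∧
      ∀ μ ∈ 𝓜, IsRTransformOn lam μ D (rGerm lam μ) := by
  have ht := h.tangentToId h0 h1
  have hex : ∀ α : Ioo 0 Real.pi, ∃ β : ℝ, 0 < β ∧ ∀ μ ∈ 𝓜, ∀ z ∈ Delta α β,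
      DifferentiableAt ℂ (rGerm lam μ) z := by
    rintro ⟨α, hα0, hαπ⟩
    have hk := one_add_cos_pos hα0 hαπ
    -- The tolerance `1 / 16` gives `‖z / H⁻¹ z - 1‖ ≤ 1 / 8`, inside the disc of radius `1 / 4`
    -- where `U` is differentiable.
    obtain ⟨β₁, hβ₁, hb₁⟩ := ht.exists_invertsAt hk (ε := 1 / 16) (by norm_num)
    obtain ⟨β₂, hβ₂, hb₂⟩ := ht.exists_differentiableAt_localInv hk
    refine ⟨min β₁ β₂, by positivity, fun μ hμ z hz => ?_⟩
    obtain ⟨hz1, hz2⟩ := (mem_Delta_iff hα0 hαπ).1 hz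
    have hz0 := ne_zero_of_mem_slit (mem_slit_of_lt_aperture hk hz1)
    have hi := hb₁ _ (mem_image_of_mem _ hμ) z hz1 (hz2.trans_le (min_le_left _ _))
    obtain ⟨hF0, hF⟩ := norm_div_sub_one_le (by norm_num) hz0 hi.norm_sub_le
    have hF4 : ‖z / localInv (rectCauchy lam μ) z - 1‖ < 1 / 4 := hF.trans_lt (by norm_num)
    have hU := differentiableAt_rectU h0 hF4
    have hd := hb₂ _ (mem_image_of_mem _ hμ) z hz1 (hz2.trans_le (min_le_right _ _))
    have hin : DifferentiableAt ℂ (fun z => z / localInv (rectCauchy lam μ) z - 1) z :=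
      (differentiableAt_fun_id.div hd hF0).sub_const 1
    exact DifferentiableAt.comp z hU hin
  choose β hβ hb using hex
  have hopen : IsOpen (⋃ α : Ioo 0 Real.pi, Delta α (β α)) :=
    isOpen_iUnion fun α => isOpen_Delta α.2.1 α.2.2
  have hsec : ∀ α : ℝ, 0 < α → α < Real.pi →
      ∃ b : ℝ, 0 < b ∧ Delta α b ⊆ ⋃ α : Ioo 0 Real.pi, Delta α (β α) :=
    fun α h0 hπ => ⟨β ⟨α, h0, hπ⟩, hβ _,
      subset_iUnion (fun α : Ioo 0 Real.pi => Delta α (β α)) ⟨α, h0, hπ⟩⟩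
  refine ⟨⋃ α : Ioo 0 Real.pi, Delta α (β α), hsec, fun μ hμ => ⟨hopen, ?_, ?_, hsec, ?_, ?_⟩⟩
  · exact iUnion_subset fun α => Delta_subset_slit α.2.1 α.2.2
  · intro z hz t ht ht1
    obtain ⟨α, hα⟩ := mem_iUnion.1 hz
    exact mem_iUnion.2 ⟨α, Delta_star α.2.1 α.2.2 hα ht ht1⟩
  · refine DifferentiableOn.analyticOnNhd (fun z hz => ?_) hopen
    obtain ⟨α, hα⟩ := mem_iUnion.1 hz
    exact (hb α μ hμ z hα).differentiableWithinAt
  · exact ⟨localInv (rectCauchy lam μ),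
      (ht.mono (by simpa using mem_image_of_mem _ hμ)).isSectorInverse,
      fun α _ _ => ⟨1, one_pos, fun z _ => rfl⟩⟩

theorem IsRTransformOn.subset_rectRDomain {lam : ℝ} {μ : Measure ℝ} {D : Set ℂ} {C : ℂ → ℂ}
    (h : IsRTransformOn lam μ D C) : D ⊆ rectRDomain lam μ := fun _ hz => ⟨D, C, h, hz⟩

theorem TightSymmetric.exists_forall_rectR {lam : ℝ} (h0 : 0 ≤ lam) (h1 : lam ≤ 1)
    {𝓜 : Set (Measure ℝ)} (h : TightSymmetric 𝓜) {α : ℝ} (hα : 0 < α) (hπ : α < Real.pi)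
    {ε : ℝ} (hε : 0 < ε) : ∃ β : ℝ, 0 < β ∧ ∀ μ ∈ 𝓜, Delta α β ⊆ rectRDomain lam μ ∧
      AnalyticOnNhd ℂ (rectR lam μ) (Delta α β) ∧
      ∀ z ∈ Delta α β, rectR lam μ z = rGerm lam μ z ∧ ‖rectR lam μ z‖ < ε ∧
        ‖z / localInv (rectCauchy lam μ) z - 1‖ < 1 / 4 ∧
        InvertsAt (rectCauchy lam μ) (1 / 16) z := by
  have ht := h.tangentToId h0 h1
  have hk := one_add_cos_pos hα hπ
  obtain ⟨D, hD, hC⟩ := h.exists_isRTransformOn h0 h1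
  obtain ⟨β, hβ, hβD⟩ := hD α hα hπ
  obtain ⟨η, hη, hU⟩ := exists_norm_rectU_lt h0 hε
  obtain ⟨β₁, hβ₁, hb₁⟩ := ht.exists_invertsAt hk (ε := min (1 / 16) (η / 4)) (by positivity)
  refine ⟨min β β₁, by positivity, fun μ hμ => ?_⟩
  have hsub : Delta α (min β β₁) ⊆ D := (Delta_mono (min_le_left _ _)).trans hβD
  have heq : ∀ z ∈ Delta α (min β β₁), rectR lam μ z = rGerm lam μ z :=
    fun z hz => rectR_eq (hC μ hμ) (hsub hz)
  refine ⟨hsub.trans (hC μ hμ).subset_rectRDomain, ?_, fun z hz => ⟨heq z hz, ?_⟩⟩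
  · exact ((hC μ hμ).analytic.mono hsub).congr (isOpen_Delta hα hπ) fun z hz => (heq z hz).symm
  · obtain ⟨hz1, hz2⟩ := (mem_Delta_iff hα hπ).1 hz
    have hz0 := ne_zero_of_mem_slit (mem_slit_of_lt_aperture hk hz1)
    have hi := hb₁ _ (mem_image_of_mem _ hμ) z hz1 (hz2.trans_le (min_le_right _ _))
    obtain ⟨-, hF⟩ := norm_div_sub_one_le ((min_le_left _ _).trans (by norm_num)) hz0
      hi.norm_sub_le
    have hm1 := min_le_left (1 / 16) (η / 4)
    have hm2 := min_le_right (1 / 16) (η / 4)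
    refine ⟨?_, by linarith, ⟨hi.mem_ball, hi.right_inv, hi.left_inv,
      hi.norm_sub_le.trans (mul_le_mul_of_nonneg_right hm1 (norm_nonneg z)), hi.expanding⟩⟩
    rw [heq z hz]
    exact hU _ (by linarith)

/-! ### Weak convergence implies convergence of the R-transforms -/

theorem equicontinuousAt_of_norm_le {ι : Type*} {f : ι → ℂ → ℂ} {Ω : Set ℂ} (hΩ : IsOpen Ω)
    (hf : ∀ i, DifferentiableOn ℂ (f i) Ω) {M : ℝ} (hM : ∀ i, ∀ z ∈ Ω, ‖f i z‖ ≤ M) {z : ℂ}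
    (hz : z ∈ Ω) : EquicontinuousAt f z := by
  obtain ⟨r, hr, hball⟩ := Metric.isOpen_iff.1 hΩ z hz
  have hsub : ∀ w ∈ Metric.ball z (r / 2), Metric.closedBall w (r / 4) ⊆ Ω := by
    intro w hw
    refine (Metric.closedBall_subset_ball' ?_).trans hball
    rw [Metric.mem_ball] at hw
    linarith
  have hder : ∀ i, ∀ w ∈ Metric.ball z (r / 2), ‖deriv (f i) w‖ ≤ M / (r / 4) := by
    intro i w hw
    refine Complex.norm_deriv_le_of_forall_mem_sphere_norm_le (by positivity)
      (DifferentiableOn.diffContOnCl ((hf i).mono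
        (Metric.closure_ball_subset_closedBall.trans (hsub w hw)))) fun u hu => ?_
    exact hM i u (hsub w hw (Metric.sphere_subset_closedBall hu))
  refine Metric.equicontinuousAt_of_continuity_modulus (fun w => M / (r / 4) * ‖w - z‖) ?_ f ?_
  · have : Continuous fun w : ℂ => M / (r / 4) * ‖w - z‖ := by fun_prop
    simpa using this.tendsto z
  · filter_upwards [Metric.ball_mem_nhds z (half_pos hr)] with w hw i
    rw [dist_comm, dist_eq_norm]
    refine (convex_ball z (r / 2)).norm_image_sub_le_of_norm_deriv_le (fun u hu => ?_) (hder i)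
      (Metric.mem_ball_self (half_pos hr)) hw
    have huΩ : u ∈ Ω := hsub u hu (Metric.mem_closedBall_self (by positivity))
    exact (hf i u huΩ).differentiableAt (hΩ.mem_nhds huΩ)

/-- A uniformly bounded holomorphic family is equicontinuous by Cauchy's estimate, and on a compact
set pointwise convergence of an equicontinuous family is uniform. -/
theorem tendstoUniformlyOn_of_pointwise {f : ℕ → ℂ → ℂ} {g : ℂ → ℂ} {Ω K : Set ℂ}
    (hΩ : IsOpen Ω) (hf : ∀ n, DifferentiableOn ℂ (f n) Ω) {M : ℝ}
    (hM : ∀ n, ∀ z ∈ Ω, ‖f n z‖ ≤ M) (hlim : ∀ z ∈ Ω, Tendsto (fun n => f n z) atTop (𝓝 (g z)))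
    (hKΩ : K ⊆ Ω) (hK : IsCompact K) : TendstoUniformlyOn f g atTop K := by
  have heq : EquicontinuousOn f K := fun z hz =>
    (equicontinuousAt_of_norm_le hΩ hf hM (hKΩ hz)).equicontinuousWithinAt K
  have h := (EquicontinuousOn.tendsto_uniformOnFun_iff_pi' (𝔖 := {K}) (by simpa using hK)
    (by simpa using heq) atTop g).2 ?_
  · exact (UniformOnFun.tendsto_iff_tendstoUniformlyOn.1 h) K rfl
  · rw [tendsto_pi_nhds]
    rintro ⟨z, hz⟩
    rw [sUnion_singleton] at hz
    exact hlim z (hKΩ hz)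

theorem IsSymmetric.of_tendsto {μ : ℕ → ProbabilityMeasure ℝ} {ν : ProbabilityMeasure ℝ}
    (hμ : ∀ n, IsSymmetric (μ n : Measure ℝ)) (h : Tendsto μ atTop (𝓝 ν)) :
    IsSymmetric (ν : Measure ℝ) := by
  have hc : Continuous fun t : ℝ => -t := continuous_neg
  have h1 := ProbabilityMeasure.tendsto_map_of_tendsto_of_continuous μ ν h hc
  have h2 : ∀ n, (μ n).map hc.measurable.aemeasurable = μ n := fun n =>
    Subtype.ext (by simpa [IsSymmetric] using hμ n)
  simp_rw [h2] at h1
  have h3 := tendsto_nhds_unique h1 h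
  have h4 := congrArg (fun m : ProbabilityMeasure ℝ => (m : Measure ℝ)) h3
  simpa [IsSymmetric] using h4

theorem tendsto_tail {μ : ℕ → ProbabilityMeasure ℝ} {ν : ProbabilityMeasure ℝ}
    (h : Tendsto μ atTop (𝓝 ν)) {s : ℝ} (hs : 0 ≤ s) :
    Tendsto (fun n => tail (μ n : Measure ℝ) s) atTop (𝓝 (tail (ν : Measure ℝ) s)) := by
  refine (ProbabilityMeasure.tendsto_iff_forall_integral_tendsto.1 h)
    (BoundedContinuousFunction.ofNormedAddCommGroup
      (fun t : ℝ => s * t ^ 2 / (1 + s * t ^ 2)) (continuous_tail_integrand hs) 1 fun t => ?_)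
  rw [Real.norm_of_nonneg (tail_integrand_mem hs t).1]
  exact (tail_integrand_mem hs t).2

theorem tendsto_psi {μ : ℕ → ProbabilityMeasure ℝ} {ν : ProbabilityMeasure ℝ}
    (h : Tendsto μ atTop (𝓝 ν)) {z : ℂ} (hz : z ∈ slit) :
    Tendsto (fun n => psi (μ n : Measure ℝ) z) atTop (𝓝 (psi (ν : Measure ℝ) z)) := by
  obtain ⟨B, hB⟩ := exists_bound_psi_integrand hz
  exact ((ProbabilityMeasure.tendsto_iff_forall_integral_rclike_tendsto ℂ).1 h)
    (BoundedContinuousFunction.ofNormedAddCommGroup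
      (fun t : ℝ => z * ((t ^ 2 : ℝ) : ℂ) / (1 - z * ((t ^ 2 : ℝ) : ℂ)))
      (continuous_psi_integrand hz) B hB)

/-- Convergence of `tail` at one `s` handles the limit and all large `n`; decreasing `s` handles the
finitely many remaining measures. -/
theorem tightSymmetric_of_tendsto {μ : ℕ → ProbabilityMeasure ℝ} {ν : ProbabilityMeasure ℝ}
    (hμ : ∀ n, IsSymmetric (μ n : Measure ℝ)) (h : Tendsto μ atTop (𝓝 ν)) :
    TightSymmetric (insert (ν : Measure ℝ) (range fun n => (μ n : Measure ℝ))) := by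
  refine ⟨?_, ?_, fun ε hε => ?_⟩
  · rintro _ (rfl | ⟨n, rfl⟩) <;> infer_instance
  · rintro _ (rfl | ⟨n, rfl⟩)
    · exact IsSymmetric.of_tendsto hμ h
    · exact hμ n
  · have hsmall : ∀ m : ProbabilityMeasure ℝ, ∀ᶠ s in 𝓝[>] (0 : ℝ), tail (m : Measure ℝ) s < ε :=
      fun m => (tendsto_tail_zero (m : Measure ℝ)).eventually_lt_const hε
    obtain ⟨s, hs, hs0⟩ := ((hsmall ν).and self_mem_nhdsWithin).exists
    have hs0 : 0 < s := hs0
    obtain ⟨N, hN⟩ := eventually_atTop.1 ((tendsto_tail h hs0.le).eventually_lt_const hs)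
    have hfin : ∀ᶠ s' in 𝓝[>] (0 : ℝ), ∀ n ∈ Finset.range N, tail (μ n : Measure ℝ) s' < ε :=
      (Finset.eventually_all _).2 fun n _ => hsmall (μ n)
    obtain ⟨s', ⟨hs', hss'⟩, hs'0⟩ := ((hfin.and
      (nhdsWithin_le_nhds (eventually_le_nhds hs0))).and self_mem_nhdsWithin).exists
    have hs'0 : 0 < s' := hs'0
    refine ⟨s', hs'0, ?_⟩
    rintro _ (rfl | ⟨n, rfl⟩)
    · exact (tail_mono _ hs'0.le hss').trans_lt hs
    · by_cases hn : n < N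
      · exact hs' n (Finset.mem_range.2 hn)
      · exact (tail_mono _ hs'0.le hss').trans_lt (hN n (not_lt.1 hn))

/-- Write `w = H_ν⁻¹(z)`. Then `H_{μ_n}(w) → H_ν(w) = z`, and as `w` and `H_{μ_n}⁻¹(z)` lie in the
same ball about `z`, expansion gives `‖H_{μ_n}⁻¹(z) - w‖ ≤ 2 ‖z - H_{μ_n}(w)‖`. -/
theorem tendsto_rectR_of_invertsAt {lam : ℝ} (h0 : 0 ≤ lam) {μ : ℕ → ProbabilityMeasure ℝ}
    {ν : ProbabilityMeasure ℝ} (hμ : ∀ n, IsSymmetric (μ n : Measure ℝ))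
    (h : Tendsto μ atTop (𝓝 ν)) {z : ℂ} (hz : z ∈ slit)
    (hn : ∀ n, InvertsAt (rectCauchy lam (μ n : Measure ℝ)) (1 / 16) z)
    (hν : InvertsAt (rectCauchy lam (ν : Measure ℝ)) (1 / 16) z)
    (hlt : ‖z / localInv (rectCauchy lam (ν : Measure ℝ)) z - 1‖ < 1 / 4) :
    Tendsto (fun n => rGerm lam (μ n : Measure ℝ) z) atTop (𝓝 (rGerm lam (ν : Measure ℝ) z)) := by
  have hz0 := ne_zero_of_mem_slit hz
  set w := localInv (rectCauchy lam (ν : Measure ℝ)) z with hw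
  have hwslit : w ∈ slit := by
    rw [mem_slit_iff] at hz ⊢
    linarith [(mem_closedBall_aperture hν.mem_ball).1]
  have hw0 := ne_zero_of_mem_slit hwslit
  have hH : Tendsto (fun n => rectCauchy lam (μ n : Measure ℝ) w) atTop (𝓝 z) := by
    have h1 : rectCauchy lam (ν : Measure ℝ) w = z := hν.right_inv
    rw [rectCauchy_eq (IsSymmetric.of_tendsto hμ h) hwslit] at h1
    have h2 : Tendsto (fun n => w * rectT lam (psi (μ n : Measure ℝ) w)) atTop
        (𝓝 (w * rectT lam (psi (ν : Measure ℝ) w))) :=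
      ((differentiableAt_rectT lam _).continuousAt.tendsto.comp (tendsto_psi h hwslit)).const_mul w
    rw [h1] at h2
    refine h2.congr fun n => (rectCauchy_eq (hμ n) hwslit).symm
  have hF : Tendsto (fun n => localInv (rectCauchy lam (μ n : Measure ℝ)) z) atTop (𝓝 w) := by
    rw [tendsto_iff_norm_sub_tendsto_zero]
    have h1 : Tendsto (fun n => 2 * ‖z - rectCauchy lam (μ n : Measure ℝ) w‖) atTop (𝓝 0) := by
      have := ((tendsto_const_nhds (x := z)).sub hH).norm.const_mul 2
      simpa using this
    refine squeeze_zero (fun n => norm_nonneg _) (fun n => ?_) h1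
    have := (hn n).expanding _ (hn n).mem_ball _ hν.mem_ball
    rwa [(hn n).right_inv] at this
  have h1 : Tendsto (fun n => z / localInv (rectCauchy lam (μ n : Measure ℝ)) z - 1) atTop
      (𝓝 (z / w - 1)) := (tendsto_const_nhds.div hF hw0).sub_const 1
  exact (differentiableAt_rectU h0 hlt).continuousAt.tendsto.comp h1

theorem exists_tendstoUniformlyOn_rectR {lam : ℝ} (h0 : 0 ≤ lam) (h1 : lam ≤ 1)
    {μ : ℕ → ProbabilityMeasure ℝ} {ν : ProbabilityMeasure ℝ}
    (hμ : ∀ n, IsSymmetric (μ n : Measure ℝ)) (h : Tendsto μ atTop (𝓝 ν)) {α : ℝ} (hα : 0 < α)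
    (hπ : α < Real.pi) : ∃ β : ℝ, 0 < β ∧ Delta α β ⊆ rectRDomain lam (ν : Measure ℝ) ∧
      (∀ n : ℕ, Delta α β ⊆ rectRDomain lam (μ n : Measure ℝ)) ∧
      ∀ K : Set ℂ, K ⊆ Delta α β → IsCompact K →
        TendstoUniformlyOn (fun n : ℕ => rectR lam (μ n : Measure ℝ))
          (rectR lam (ν : Measure ℝ)) atTop K := by
  obtain ⟨β, hβ, hb⟩ := (tightSymmetric_of_tendsto hμ h).exists_forall_rectR h0 h1 hα hπ one_pos
  have hbν := hb _ (mem_insert _ _)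
  have hbn := fun n => hb _ (mem_insert_of_mem _ (mem_range_self n))
  refine ⟨β, hβ, hbν.1, fun n => (hbn n).1, fun K hK hKc => ?_⟩
  refine tendstoUniformlyOn_of_pointwise (isOpen_Delta hα hπ)
    (fun n => (hbn n).2.1.differentiableOn) (fun n z hz => ((hbn n).2.2 z hz).2.1.le)
    (fun z hz => ?_) hK hKc
  obtain ⟨h2, -, h3, h4⟩ := hbν.2.2 z hz
  rw [h2]
  refine (tendsto_rectR_of_invertsAt h0 hμ h (Delta_subset_slit hα hπ hz)
    (fun n => ((hbn n).2.2 z hz).2.2.2) h4 h3).congr fun n => ((hbn n).2.2 z hz).1.symm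

/-! ### The identity `ψ_μ (z / T (C_μ z)) = C_μ z` and tightness -/

theorem tightSymmetric_singleton {μ : Measure ℝ} [hp : IsProbabilityMeasure μ]
    (hμ : IsSymmetric μ) : TightSymmetric {μ} := by
  refine ⟨?_, ?_, fun ε hε => ?_⟩
  · rintro _ rfl; exact hp
  · rintro _ rfl; exact hμ
  · obtain ⟨s, hs, hs0⟩ :=
      (((tendsto_tail_zero μ).eventually_lt_const hε).and self_mem_nhdsWithin).exists
    exact ⟨s, hs0, by rintro _ rfl; exact hs⟩

/-- Here `‖T(c) - 1‖ ≤ 3 / 16` and `‖T(c)‖ ≥ 13 / 16`, and `3 / 13 ≤ 1 / 4`. This is the source of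
the threshold `1 / 16` in the continuation arguments. -/
theorem norm_div_rectT_sub_le {lam : ℝ} (h0 : 0 ≤ lam) (h1 : lam ≤ 1) {c : ℂ}
    (hc : ‖c‖ < 1 / 16) (z : ℂ) : rectT lam c ≠ 0 ∧ ‖z / rectT lam c - z‖ ≤ 1 / 4 * ‖z‖ := by
  have h2 := norm_rectT_sub_one_le h0 h1 (x := c) (by linarith)
  have h3 : 13 / 16 ≤ ‖rectT lam c‖ := by
    have := norm_sub_norm_le 1 (1 - rectT lam c)
    rw [norm_one, norm_sub_rev, sub_sub_cancel] at this
    linarith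
  have hT : rectT lam c ≠ 0 := by
    rintro h
    rw [h, norm_zero] at h3
    norm_num at h3
  refine ⟨hT, ?_⟩
  have h4 : z / rectT lam c - z = z * (1 - rectT lam c) / rectT lam c := by field_simp
  rw [h4, norm_div, norm_mul, norm_sub_rev, div_le_iff₀ (norm_pos_iff.2 hT)]
  nlinarith [norm_nonneg z]

theorem mem_Delta_pi_div_two_iff {β : ℝ} {z : ℂ} :
    z ∈ Delta (Real.pi / 2) β ↔ ‖z‖ < aperture z ∧ ‖z‖ < β := by
  rw [mem_Delta_iff (by positivity) (by linarith [Real.pi_pos]), Real.cos_pi_div_two, add_zero,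
    one_mul]

/-- With `F` the sector inverse, both `C z` and `ψ_μ(F z)` are solutions `x` of `T(x) = z / F z`
with `‖x‖ < 1 / 2`, and `T` is injective there. -/
theorem IsRTransformOn.exists_psi_eq {lam : ℝ} (h0 : 0 ≤ lam) {μ : Measure ℝ}
    [IsProbabilityMeasure μ] (hμ : IsSymmetric μ) {D : Set ℂ} {C : ℂ → ℂ}
    (h : IsRTransformOn lam μ D C) : ∃ β : ℝ, 0 < β ∧ ∀ z ∈ Delta (Real.pi / 2) β,
      ‖C z‖ < 1 / 2 → psi μ (z / rectT lam (C z)) = C z := by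
  have hp1 : 0 < Real.pi / 2 := by positivity
  have hp2 : Real.pi / 2 < Real.pi := by linarith
  obtain ⟨F, hF, hC⟩ := h.germ
  obtain ⟨β₁, hβ₁, hb₁⟩ := hC _ hp1 hp2
  obtain ⟨-, hlim, β₂, hβ₂, hb₂⟩ := hF _ hp1 hp2
  obtain ⟨β₃, hβ₃, hb₃⟩ := (tightSymmetric_singleton hμ).norm_psi_lt (k := 1 / 4) (by norm_num)
    (ε := 1 / 2) (by norm_num)
  have hev : ∀ᶠ z in 𝓝[sector (Real.pi / 2)] (0 : ℂ), ‖F z / z - 1‖ < 1 / 4 := by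
    have := Metric.tendsto_nhds.1 hlim (1 / 4) (by norm_num)
    simpa [dist_eq_norm] using this
  obtain ⟨β₄, hβ₄, hb₄⟩ := Metric.mem_nhdsWithin_iff.1 hev
  refine ⟨min (min β₁ β₂) (min (β₃ / 2) β₄), by positivity, fun z hz hCz => ?_⟩
  have hz1 : z ∈ Delta (Real.pi / 2) β₁ :=
    Delta_mono ((min_le_left _ _).trans (min_le_left _ _)) hz
  have hz2 : z ∈ Delta (Real.pi / 2) β₂ :=
    Delta_mono ((min_le_left _ _).trans (min_le_right _ _)) hz
  have hz3 : ‖z‖ < β₃ / 2 := hz.2.trans_le ((min_le_right _ _).trans (min_le_left _ _))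
  have hz4 : ‖F z / z - 1‖ < 1 / 4 :=
    hb₄ ⟨by simpa using hz.2.trans_le ((min_le_right _ _).trans (min_le_right _ _)), hz.1⟩
  have ha := (mem_Delta_pi_div_two_iff.1 hz).1
  have hz0 : z ≠ 0 := hz.1.1
  have hn := norm_pos_iff.2 hz0
  have hFz : ‖F z - z‖ ≤ 1 / 4 * ‖z‖ := by
    have e : F z - z = (F z / z - 1) * z := by field_simp
    rw [e, norm_mul]
    gcongr
  have hFa := aperture_sub_le z (F z)
  rw [norm_sub_rev] at hFa
  have hFn := norm_sub_norm_le (F z) z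
  have hFslit : F z ∈ slit := mem_slit_iff.2 (by linarith)
  have hF0 := ne_zero_of_mem_slit hFslit
  have hT : rectT lam (C z) = z / F z := by
    rw [hb₁ z hz1, rectT_rectU]; ring
  have hψ : ‖psi μ (F z)‖ < 1 / 2 := hb₃ μ rfl (F z) (by linarith) (by linarith)
  have hHF : F z * rectT lam (psi μ (F z)) = z := by
    rw [← rectCauchy_eq hμ hFslit]
    exact (hb₂ z hz2).1
  have hK : z / rectT lam (C z) = F z := by rw [hT]; field_simp
  rw [hK]
  refine rectT_injective h0 hψ hCz ?_
  rw [hT, eq_div_iff hF0, mul_comm]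
  exact hHF

theorem mem_slit_of_norm_sub_le {x : ℝ} (hx : x < 0) {w : ℂ} (h : ‖w - x‖ ≤ 1 / 4 * ‖(x : ℂ)‖) :
    w ∈ slit ∧ w.re ≤ 0 ∧ -x / 2 ≤ ‖w‖ := by
  rw [Complex.norm_real, Real.norm_of_nonpos hx.le] at h
  have h2 := (abs_le.1 ((Complex.abs_re_le_norm (w - x)).trans h)).2
  rw [Complex.sub_re, Complex.ofReal_re] at h2
  have h3 := (abs_le.1 (Complex.abs_re_le_norm w)).1
  refine ⟨mem_slit_iff.2 ?_, by linarith, by linarith⟩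
  unfold aperture
  linarith

theorem analyticAt_psi (μ : Measure ℝ) [IsFiniteMeasure μ] {z : ℂ} (hz : z ∈ slit) :
    AnalyticAt ℂ (psi μ) z :=
  DifferentiableOn.analyticAt (s := slit)
    (fun _ hw => (differentiableAt_psi μ hw).differentiableWithinAt) (isOpen_slit.mem_nhds hz)

theorem analyticAt_rectT (lam : ℝ) (x : ℂ) : AnalyticAt ℂ (rectT lam) x :=
  Differentiable.analyticAt (differentiableAt_rectT lam) x

/-- Both sides are analytic along the segment to `x`: smallness of the transform keeps `z / T(C z)`
within `‖z‖ / 4` of `z`, hence off `[0, ∞)`. They agree near one of its points close to `0`, so the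
identity theorem applies. Smallness on the whole segment is needed, not just at `x`. -/
theorem psi_div_rectT_rectR {lam : ℝ} (h0 : 0 ≤ lam) (h1 : lam ≤ 1) {μ : Measure ℝ}
    [IsProbabilityMeasure μ] (hμ : IsSymmetric μ) {x : ℝ} (hx : x < 0)
    (hdom : (x : ℂ) ∈ rectRDomain lam μ)
    (hsmall : ∀ y : ℝ, x ≤ y → y < 0 → ‖rectR lam μ (y : ℂ)‖ < 1 / 16) :
    psi μ (x / rectT lam (rectR lam μ x)) = rectR lam μ x := by
  obtain ⟨D, C, hC, hxD⟩ := hdom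
  set S : Set ℂ := (fun t : ℝ => ((t * x : ℝ) : ℂ)) '' Ioc 0 1 with hS
  have hSpre : IsPreconnected S := isPreconnected_Ioc.image _ (by fun_prop)
  have hmem : ∀ t ∈ Ioc (0 : ℝ) 1, ((t * x : ℝ) : ℂ) ∈ D := by
    intro t ht
    have := hC.star x hxD t ht.1 ht.2
    rwa [← Complex.ofReal_mul] at this
  have hCs : ∀ t ∈ Ioc (0 : ℝ) 1, ‖C ((t * x : ℝ) : ℂ)‖ < 1 / 16 := by
    intro t ht
    rw [← rectR_eq hC (hmem t ht)]
    exact hsmall _ (by nlinarith [ht.2]) (mul_neg_of_pos_of_neg ht.1 hx)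
  have hSD : S ⊆ D := by rintro _ ⟨t, ht, rfl⟩; exact hmem t ht
  have hxS : (x : ℂ) ∈ S := ⟨1, by simp, by simp⟩
  have hCan : AnalyticOnNhd ℂ C S := hC.analytic.mono hSD
  have hψan : AnalyticOnNhd ℂ (fun w => psi μ (w / rectT lam (C w))) S := by
    rintro _ ⟨t, ht, rfl⟩
    obtain ⟨hT, hle⟩ := norm_div_rectT_sub_le h0 h1 (hCs t ht) ((t * x : ℝ) : ℂ)
    have hsl := (mem_slit_of_norm_sub_le (mul_neg_of_pos_of_neg ht.1 hx) hle).1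
    have hin : AnalyticAt ℂ (fun w => w / rectT lam (C w)) ((t * x : ℝ) : ℂ) :=
      analyticAt_id.div ((analyticAt_rectT lam _).comp (hC.analytic _ (hmem t ht))) hT
    exact AnalyticAt.comp (f := fun w => w / rectT lam (C w)) (analyticAt_psi μ hsl) hin
  obtain ⟨β, hβ, hb⟩ := hC.exists_psi_eq h0 hμ
  set t : ℝ := min 1 (β / (2 * -x)) with ht
  have hx' : 0 < -x := neg_pos.2 hx
  have ht0 : 0 < t := by positivity
  have htI : t ∈ Ioc (0 : ℝ) 1 := ⟨ht0, min_le_left _ _⟩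
  have htx : t * x < 0 := mul_neg_of_pos_of_neg ht0 hx
  have htβ : -β < t * x := by
    have h2 : t ≤ β / (2 * -x) := min_le_right _ _
    rw [le_div_iff₀ (by positivity)] at h2
    linarith
  have hp1 : 0 < Real.pi / 2 := by positivity
  have hp2 : Real.pi / 2 < Real.pi := by linarith
  have hev : (fun w => psi μ (w / rectT lam (C w))) =ᶠ[𝓝 ((t * x : ℝ) : ℂ)] C := by
    filter_upwards [(isOpen_Delta hp1 hp2).mem_nhds (ofReal_mem_Delta hp1 htx htβ),
      (hC.analytic _ (hmem t htI)).continuousAt.norm.eventually_lt_const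
        ((hCs t htI).trans (by norm_num : (1 : ℝ) / 16 < 1 / 2))] with w hw1 hw2
    exact hb w hw1 hw2
  have := hψan.eqOn_of_preconnected_of_eventuallyEq hCan hSpre ⟨t, htI, rfl⟩ hev hxS
  rw [rectR_eq hC hxD]
  exact this

/-- For `Re u ≤ 0`, minus the real part of the kernel is nonnegative, and it is at least `1 / 4`
once `‖u‖ t² ≥ 1`, because then `‖1 - u t²‖ ≤ 2 ‖u‖ t²`. Markov's inequality concludes. -/
theorem measureReal_le_norm_psi (μ : Measure ℝ) [IsFiniteMeasure μ] {u : ℂ} (hu : u ∈ slit)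
    (hre : u.re ≤ 0) : μ.real {t : ℝ | 1 ≤ ‖u‖ * t ^ 2} ≤ 4 * ‖psi μ u‖ := by
  set f : ℝ → ℂ := fun t => u * ((t ^ 2 : ℝ) : ℂ) / (1 - u * ((t ^ 2 : ℝ) : ℂ)) with hf
  have hint : Integrable f μ := integrable_psi_integrand μ hu
  have hre_eq : ∀ t : ℝ, -(f t).re = (-u.re * t ^ 2 + (‖u‖ * t ^ 2) ^ 2) /
      ‖1 - u * ((t ^ 2 : ℝ) : ℂ)‖ ^ 2 := by
    intro t
    rw [hf, Complex.div_re, ← add_div, ← Complex.normSq_eq_norm_sq, ← neg_div, mul_pow,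
      ← Complex.normSq_eq_norm_sq, Complex.normSq_apply u]
    congr 1
    simp only [Complex.mul_re, Complex.mul_im, Complex.ofReal_re, Complex.ofReal_im, Complex.sub_re,
      Complex.sub_im, Complex.one_re, Complex.one_im]
    ring
  have hnonneg : ∀ t : ℝ, 0 ≤ -(f t).re := by
    intro t
    rw [hre_eq]
    have : 0 ≤ -u.re * t ^ 2 := mul_nonneg (by linarith) (sq_nonneg t)
    positivity
  have hsub : {t : ℝ | 1 ≤ ‖u‖ * t ^ 2} ⊆ {t : ℝ | 1 / 4 ≤ -(f t).re} := by
    intro t ht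
    rw [Set.mem_ofPred_eq] at ht ⊢
    have hpos : 0 < ‖1 - u * ((t ^ 2 : ℝ) : ℂ)‖ :=
      norm_pos_iff.2 (one_sub_mul_ne_zero hu (sq_nonneg t))
    have hle : ‖1 - u * ((t ^ 2 : ℝ) : ℂ)‖ ≤ 2 * (‖u‖ * t ^ 2) := by
      refine (norm_sub_le _ _).trans ?_
      rw [norm_one, norm_mul, Complex.norm_real, Real.norm_of_nonneg (sq_nonneg t)]
      linarith
    have h2 : 0 ≤ -u.re * t ^ 2 := mul_nonneg (by linarith) (sq_nonneg t)
    rw [hre_eq, le_div_iff₀ (by positivity)]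
    nlinarith
  have hmark := mul_meas_ge_le_integral_of_nonneg (μ := μ) (Eventually.of_forall hnonneg)
    hint.re.neg (1 / 4)
  have hmono : μ.real {t : ℝ | 1 ≤ ‖u‖ * t ^ 2} ≤ μ.real {t : ℝ | 1 / 4 ≤ -(f t).re} :=
    measureReal_mono hsub
  have hI : ∫ t, -(f t).re ∂μ ≤ ‖psi μ u‖ := by
    have h3 : ∫ t, (f t).re ∂μ = (psi μ u).re := integral_re hint
    rw [integral_neg, h3]
    have := (abs_le.1 (Complex.abs_re_le_norm (psi μ u))).1
    linarith
  have hmark' : 1 / 4 * μ.real {t : ℝ | 1 / 4 ≤ -(f t).re} ≤ ∫ t, -(f t).re ∂μ := hmark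
  linarith

theorem isTightMeasureSet_of_rectR {lam : ℝ} (h0 : 0 ≤ lam) (h1 : lam ≤ 1)
    {μ : ℕ → ProbabilityMeasure ℝ} (hμ : ∀ n, IsSymmetric (μ n : Measure ℝ))
    (h : ∀ ε : ℝ, 0 < ε → ∃ δ : ℝ, 0 < δ ∧ ∀ n : ℕ, ∀ x : ℝ, -δ < x → x < 0 →
      (x : ℂ) ∈ rectRDomain lam (μ n : Measure ℝ) ∧
        ‖rectR lam (μ n : Measure ℝ) (x : ℂ)‖ < ε) :
    IsTightMeasureSet (range fun n => (μ n : Measure ℝ)) := by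
  rw [isTightMeasureSet_iff_exists_isCompact_measure_compl_le]
  intro ε hε
  obtain ⟨r, hr0, hr⟩ := ENNReal.lt_iff_exists_nnreal_btwn.1 hε
  have hr0 : (0 : ℝ) < r := by exact_mod_cast hr0
  obtain ⟨δ, hδ, hb⟩ := h (min (1 / 16) (r / 4)) (by positivity)
  -- The transform is evaluated at `-δ / 2`, so `ψ` is taken at a point of norm at least `δ / 4`.
  -- The summand `1` gives `R ≥ 1`, whence `|t| > R` implies `t² ≥ R`.
  set R : ℝ := 4 / δ + 1 with hR
  have hR1 : 1 ≤ R := by rw [hR]; have : 0 < 4 / δ := by positivity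
                         linarith
  refine ⟨Metric.closedBall 0 R, isCompact_closedBall 0 R, ?_⟩
  rintro _ ⟨n, rfl⟩
  have hx : -(δ / 2) < 0 := by linarith
  obtain ⟨hdom, hlt⟩ := hb n (-(δ / 2)) (by linarith) hx
  set c := rectR lam (μ n : Measure ℝ) ((-(δ / 2) : ℝ) : ℂ) with hc
  have hψ : psi (μ n : Measure ℝ) (((-(δ / 2) : ℝ) : ℂ) / rectT lam c) = c :=
    psi_div_rectT_rectR h0 h1 (hμ n) hx hdom fun y hy hy0 =>
      ((hb n y (by linarith) hy0).2).trans_le (min_le_left _ _)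
  obtain ⟨-, hle⟩ := norm_div_rectT_sub_le h0 h1 (hlt.trans_le (min_le_left _ _))
    ((-(δ / 2) : ℝ) : ℂ)
  obtain ⟨hs, hre, hnorm⟩ := mem_slit_of_norm_sub_le hx hle
  have hmass := measureReal_le_norm_psi (μ n : Measure ℝ) hs hre
  rw [hψ] at hmass
  have hsub : (Metric.closedBall (0 : ℝ) R)ᶜ ⊆
      {t : ℝ | 1 ≤ ‖((-(δ / 2) : ℝ) : ℂ) / rectT lam c‖ * t ^ 2} := by
    intro t ht
    rw [mem_compl_iff, mem_closedBall_zero_iff, not_le, Real.norm_eq_abs] at ht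
    rw [Set.mem_ofPred_eq]
    have h2 : R ≤ t ^ 2 := by rw [← sq_abs]; nlinarith
    have h3 : 1 ≤ δ / 4 * R := by
      rw [hR]
      have : δ / 4 * (4 / δ + 1) = 1 + δ / 4 := by field_simp
      rw [this]; linarith
    have h4 : δ / 4 ≤ ‖((-(δ / 2) : ℝ) : ℂ) / rectT lam c‖ := by linarith
    calc 1 ≤ δ / 4 * R := h3
      _ ≤ _ := by gcongr
  have hreal : (μ n : Measure ℝ).real (Metric.closedBall (0 : ℝ) R)ᶜ ≤ r := by
    have h2 : ‖c‖ < r / 4 := hlt.trans_le (min_le_right _ _)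
    have h3 := measureReal_mono (μ := (μ n : Measure ℝ)) hsub
    linarith
  refine le_trans ?_ hr.le
  rw [measureReal_def] at hreal
  have := (ENNReal.le_ofReal_iff_toReal_le (measure_ne_top _ _) hr0.le).2 hreal
  simpa using this

/-! ### A symmetric measure is determined by `ψ_μ` -/

theorem integrable_of_continuous_unitInterval (P : Measure unitInterval) [IsFiniteMeasure P]
    {f : unitInterval → ℝ} (hf : Continuous f) : Integrable f P :=
  (BoundedContinuousFunction.mkOfCompact ⟨f, hf⟩).integrable P

theorem one_sub_mul_pos {r : ℝ} (hr : r < 1) (x : unitInterval) : 0 < 1 - r * (x : ℝ) := by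
  have h0 := x.2.1
  have h1 := x.2.2
  rcases le_or_gt r 0 with h | h <;> nlinarith

theorem continuous_geomKernel {r : ℝ} (hr : r < 1) (n : ℕ) :
    Continuous fun x : unitInterval => (1 - (x : ℝ)) * (x : ℝ) ^ n / (1 - r * (x : ℝ)) :=
  Continuous.div (by fun_prop) (by fun_prop) fun x => (one_sub_mul_pos hr x).ne'

theorem geomKernel_mem {r : ℝ} (hr : r < 1) (n : ℕ) (x : unitInterval) :
    0 ≤ (1 - (x : ℝ)) * (x : ℝ) ^ n / (1 - r * (x : ℝ)) ∧
      (1 - (x : ℝ)) * (x : ℝ) ^ n / (1 - r * (x : ℝ)) ≤ 1 := by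
  have h0 := x.2.1
  have h1 := x.2.2
  have hp := one_sub_mul_pos hr x
  have h2 : 0 ≤ 1 - (x : ℝ) := by linarith
  refine ⟨by positivity, (div_le_one hp).2 ?_⟩
  have h3 : (x : ℝ) ^ n ≤ 1 := pow_le_one₀ h0 h1
  nlinarith

theorem tendsto_integral_geomKernel (P : Measure unitInterval) [IsFiniteMeasure P] (n : ℕ) :
    Tendsto (fun r : ℝ => ∫ x : unitInterval, (1 - (x : ℝ)) * (x : ℝ) ^ n / (1 - r * (x : ℝ)) ∂P)
      (𝓝[>] 0) (𝓝 (∫ x : unitInterval, (1 - (x : ℝ)) * (x : ℝ) ^ n ∂P)) := by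
  have hev : ∀ᶠ r in 𝓝[>] (0 : ℝ), r < 1 := nhdsWithin_le_nhds (eventually_lt_nhds one_pos)
  refine tendsto_integral_filter_of_dominated_convergence (fun _ => (1 : ℝ)) ?_ ?_
    (integrable_const _) (Eventually.of_forall fun x => ?_)
  · filter_upwards [hev] with r hr
    exact (continuous_geomKernel hr n).aestronglyMeasurable
  · filter_upwards [hev] with r hr
    refine Eventually.of_forall fun x => ?_
    rw [Real.norm_of_nonneg (geomKernel_mem hr n x).1]
    exact (geomKernel_mem hr n x).2
  · have hc : ContinuousAt
        (fun r : ℝ => (1 - (x : ℝ)) * (x : ℝ) ^ n / (1 - r * (x : ℝ))) 0 :=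
      ContinuousAt.div (by fun_prop) (by fun_prop) (by simp)
    have := hc.tendsto
    simp only [zero_mul, sub_zero, div_one] at this
    exact this.mono_left nhdsWithin_le_nhds

/-- The integral is the generating function in `r` of the numbers `∫ (1 - x) xⁿ`. They are peeled
off one at a time: let `r → 0`, subtract the constant term, divide by `r`. The moments follow by
telescoping `xⁿ⁺¹ = xⁿ - (1 - x) xⁿ` from total mass `1`. -/
theorem integral_pow_eq_of_geomKernel {P P' : Measure unitInterval} [IsProbabilityMeasure P]
    [IsProbabilityMeasure P']
    (h : ∀ r : ℝ, 0 < r → r < 1 → ∫ x : unitInterval, (1 - (x : ℝ)) / (1 - r * (x : ℝ)) ∂P =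
      ∫ x : unitInterval, (1 - (x : ℝ)) / (1 - r * (x : ℝ)) ∂P') (n : ℕ) :
    ∫ x : unitInterval, (x : ℝ) ^ n ∂P = ∫ x : unitInterval, (x : ℝ) ^ n ∂P' := by
  have hlim : ∀ n : ℕ, (∀ r : ℝ, 0 < r → r < 1 →
      ∫ x : unitInterval, (1 - (x : ℝ)) * (x : ℝ) ^ n / (1 - r * (x : ℝ)) ∂P =
      ∫ x : unitInterval, (1 - (x : ℝ)) * (x : ℝ) ^ n / (1 - r * (x : ℝ)) ∂P') →
      ∫ x : unitInterval, (1 - (x : ℝ)) * (x : ℝ) ^ n ∂P =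
      ∫ x : unitInterval, (1 - (x : ℝ)) * (x : ℝ) ^ n ∂P' := by
    intro n hn
    refine tendsto_nhds_unique (tendsto_integral_geomKernel P n)
      ((tendsto_integral_geomKernel P' n).congr' ?_)
    filter_upwards [self_mem_nhdsWithin, nhdsWithin_le_nhds (eventually_lt_nhds one_pos)]
      with r hr0 hr1
    exact (hn r hr0 hr1).symm
  have hker : ∀ n : ℕ, ∀ r : ℝ, 0 < r → r < 1 →
      ∫ x : unitInterval, (1 - (x : ℝ)) * (x : ℝ) ^ n / (1 - r * (x : ℝ)) ∂P =
      ∫ x : unitInterval, (1 - (x : ℝ)) * (x : ℝ) ^ n / (1 - r * (x : ℝ)) ∂P' := by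
    intro n
    induction n with
    | zero => simpa using h
    | succ n ih =>
      intro r hr0 hr1
      have hstep : ∀ (Q : Measure unitInterval) [IsFiniteMeasure Q],
          ∫ x : unitInterval, (1 - (x : ℝ)) * (x : ℝ) ^ (n + 1) / (1 - r * (x : ℝ)) ∂Q =
          r⁻¹ * (∫ x : unitInterval, (1 - (x : ℝ)) * (x : ℝ) ^ n / (1 - r * (x : ℝ)) ∂Q -
            ∫ x : unitInterval, (1 - (x : ℝ)) * (x : ℝ) ^ n ∂Q) := by
        intro Q _
        rw [← integral_sub
          (integrable_of_continuous_unitInterval Q (continuous_geomKernel hr1 n))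
          (integrable_of_continuous_unitInterval Q (by fun_prop)), ← integral_const_mul]
        refine integral_congr_ae (Eventually.of_forall fun x => ?_)
        have hx := (one_sub_mul_pos hr1 x).ne'
        have hr := hr0.ne'
        simp only
        rw [eq_inv_mul_iff_mul_eq₀ hr, eq_sub_iff_add_eq, eq_div_iff hx, add_mul, mul_assoc r,
          div_mul_cancel₀ _ hx]
        ring
      rw [hstep P, hstep P', ih r hr0 hr1, hlim n ih]
  induction n with
  | zero => simp
  | succ n ih =>
    have hstep : ∀ (Q : Measure unitInterval) [IsFiniteMeasure Q],
        ∫ x : unitInterval, (x : ℝ) ^ (n + 1) ∂Q = ∫ x : unitInterval, (x : ℝ) ^ n ∂Q -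
          ∫ x : unitInterval, (1 - (x : ℝ)) * (x : ℝ) ^ n ∂Q := by
      intro Q _
      rw [← integral_sub (integrable_of_continuous_unitInterval Q (by fun_prop))
        (integrable_of_continuous_unitInterval Q (by fun_prop))]
      refine integral_congr_ae (Eventually.of_forall fun x => ?_)
      simp only
      ring
    rw [hstep P, hstep P', ih, hlim n (hker n)]

theorem Measure.ext_of_integral_pow_unitInterval {P P' : Measure unitInterval} [IsFiniteMeasure P]
    [IsFiniteMeasure P']
    (h : ∀ n : ℕ, ∫ x : unitInterval, (x : ℝ) ^ n ∂P = ∫ x : unitInterval, (x : ℝ) ^ n ∂P') :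
    P = P' := by
  have hpoly : ∀ p : Polynomial ℝ, ∫ x : unitInterval, p.eval (x : ℝ) ∂P =
      ∫ x : unitInterval, p.eval (x : ℝ) ∂P' := by
    intro p
    simp_rw [Polynomial.eval_eq_sum_range]
    rw [integral_finsetSum _ fun i _ =>
        integrable_of_continuous_unitInterval P (by fun_prop),
      integral_finsetSum _ fun i _ =>
        integrable_of_continuous_unitInterval P' (by fun_prop)]
    refine Finset.sum_congr rfl fun i _ => ?_
    rw [integral_const_mul, integral_const_mul, h]
  refine ext_of_forall_integral_eq_of_IsFiniteMeasure fun f => ?_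
  by_contra hne
  set d := |∫ x, f x ∂P - ∫ x, f x ∂P'| with hd
  have hd0 : 0 < d := abs_pos.2 (sub_ne_zero.2 hne)
  -- The extra `1` makes the total error `d - d / M`, strictly below `d`, which is the
  -- contradiction.
  set M := P.real univ + P'.real univ + 1 with hM
  have hM0 : 0 < M := by positivity
  obtain ⟨p, hp⟩ := exists_polynomial_near_continuousMap 0 1 f.toContinuousMap (d / M)
    (by positivity)
  have hle : ∀ (Q : Measure unitInterval) [IsFiniteMeasure Q],
      |∫ x : unitInterval, p.eval (x : ℝ) ∂Q - ∫ x, f x ∂Q| ≤ d / M * Q.real univ := by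
    intro Q _
    rw [← integral_sub (integrable_of_continuous_unitInterval Q (by fun_prop))
      (integrable_of_continuous_unitInterval Q f.continuous), ← Real.norm_eq_abs]
    refine norm_integral_le_of_norm_le_const (Eventually.of_forall fun x => ?_)
    exact ((p.toContinuousMapOn (Icc 0 1) - f.toContinuousMap).norm_coe_le_norm x).trans hp.le
  have h1 := hle P
  have h2 := hle P'
  rw [hpoly p] at h1
  have h3 : d ≤ d / M * P.real univ + d / M * P'.real univ := by
    rw [abs_sub_comm] at h1
    exact (abs_sub_le _ (∫ x : unitInterval, p.eval (x : ℝ) ∂P') _).trans (add_le_add h1 h2)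
  have h4 : d / M * P.real univ + d / M * P'.real univ = d - d / M := by
    rw [hM]; field_simp; ring
  have : 0 < d / M := by positivity
  linarith

/-- The map `t ↦ t² / (1 + t²)` onto `[0, 1)`. -/
def compress (t : ℝ) : unitInterval :=
  ⟨t ^ 2 / (1 + t ^ 2), by positivity, (div_le_one (by positivity)).2 (by linarith)⟩

theorem measurable_compress : Measurable compress := by
  refine Measurable.subtype_mk ?_
  fun_prop

/-- At `x = t² / (1 + t²)` the kernel becomes `1 / (1 + (1 - r) t²)`. -/
theorem integral_map_compress (μ : Measure ℝ) [IsProbabilityMeasure μ] {r : ℝ} (hr : r < 1) :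
    ∫ x : unitInterval, (1 - (x : ℝ)) / (1 - r * (x : ℝ)) ∂(μ.map compress) =
      1 - tail μ (1 - r) := by
  have hcont : Continuous fun x : unitInterval => (1 - (x : ℝ)) / (1 - r * (x : ℝ)) := by
    simpa using continuous_geomKernel hr 0
  rw [integral_map measurable_compress.aemeasurable hcont.aestronglyMeasurable]
  have h1 : (1 : ℝ) = ∫ _ : ℝ, (1 : ℝ) ∂μ := by simp
  have hs : 0 < 1 - r := by linarith
  calc _ = ∫ t : ℝ, (1 - (1 - r) * t ^ 2 / (1 + (1 - r) * t ^ 2)) ∂μ := by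
        refine integral_congr_ae (Eventually.of_forall fun t => ?_)
        have h2 : (1 + t ^ 2 : ℝ) ≠ 0 := by positivity
        have h3 : 1 + (1 - r) * t ^ 2 ≠ 0 := by positivity
        have h4 : 1 - r * (t ^ 2 / (1 + t ^ 2)) = (1 + (1 - r) * t ^ 2) / (1 + t ^ 2) := by
          field_simp; ring
        simp only [compress]
        rw [h4]
        field_simp
        ring
    _ = _ := by
        rw [integral_sub (integrable_const _) (integrable_tail_integrand μ hs.le), ← h1, tail]

theorem psi_neg_ofReal (μ : Measure ℝ) (s : ℝ) : psi μ ((-s : ℝ) : ℂ) = ((-tail μ s : ℝ) : ℂ) := by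
  rw [psi, tail, ← integral_neg, ← integral_complex_ofReal]
  refine integral_congr_ae (Eventually.of_forall fun t => ?_)
  push_cast
  rw [neg_mul, sub_neg_eq_add, neg_div]

/-- A reflection-invariant set is its own preimage under `|·|`, so the measures agree on such sets.
For general `A`, both `A ∪ -A` and `A ∩ -A` are invariant and their masses add up to twice that of
`A`. -/
theorem IsSymmetric.ext_of_map_abs {μ ν : Measure ℝ} (hμ : IsSymmetric μ)
    (hν : IsSymmetric ν) (h : μ.map (fun t => |t|) = ν.map (fun t => |t|)) : μ = ν := by
  have hmeas : Measurable fun t : ℝ => |t| := by fun_prop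
  have hneg : Measurable fun t : ℝ => -t := measurable_neg
  have hsym : ∀ B : Set ℝ, MeasurableSet B → (∀ t, -t ∈ B ↔ t ∈ B) → μ B = ν B := by
    intro B hB hs
    have hpre : (fun t : ℝ => |t|) ⁻¹' B = B := by
      ext t
      rcases abs_choice t with ht | ht <;> simp [ht, hs]
    have := congrArg (fun m => m B) h
    simpa only [Measure.map_apply hmeas hB, hpre] using this
  have hdouble : ∀ m : Measure ℝ, IsSymmetric m → ∀ A : Set ℝ, MeasurableSet A →
      m (A ∪ (fun t => -t) ⁻¹' A) + m (A ∩ (fun t => -t) ⁻¹' A) = 2 * m A := by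
    intro m hm A hA
    have h1 : m ((fun t => -t) ⁻¹' A) = m A := by
      rw [← Measure.map_apply hneg hA, hm]
    rw [measure_union_add_inter A (hneg hA), h1, two_mul]
  ext A hA
  have h1 := hdouble μ hμ A hA
  have h2 := hdouble ν hν A hA
  rw [hsym _ (hA.union (hneg hA)) (fun t => by simp [or_comm]),
    hsym _ (hA.inter (hneg hA)) (fun t => by simp [and_comm]), h2] at h1
  exact ((ENNReal.mul_right_inj (by norm_num) (by norm_num)).1 h1).symm

/-- The values of `ψ` on the negative axis give `tail`, hence the moments of the image under
`compress`, hence that image; `√(x / (1 - x))` recovers `|t|` from it, and symmetry does the rest.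
-/
theorem IsSymmetric.ext_of_psi {μ ν : Measure ℝ} [IsProbabilityMeasure μ] [IsProbabilityMeasure ν]
    (hμ : IsSymmetric μ) (hν : IsSymmetric ν) (h : ∀ z ∈ slit, psi μ z = psi ν z) : μ = ν := by
  have htail : ∀ s : ℝ, 0 < s → tail μ s = tail ν s := by
    intro s hs
    have := h _ (ofReal_mem_slit (neg_neg_of_pos hs))
    rw [psi_neg_ofReal, psi_neg_ofReal] at this
    exact neg_injective (by exact_mod_cast this)
  have h1 : IsProbabilityMeasure (μ.map compress) :=
    Measure.isProbabilityMeasure_map measurable_compress.aemeasurable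
  have h2 : IsProbabilityMeasure (ν.map compress) :=
    Measure.isProbabilityMeasure_map measurable_compress.aemeasurable
  have hP : μ.map compress = ν.map compress := by
    refine Measure.ext_of_integral_pow_unitInterval (integral_pow_eq_of_geomKernel fun r _ hr => ?_)
    rw [integral_map_compress μ hr, integral_map_compress ν hr, htail _ (by linarith)]
  have hg : Measurable fun x : unitInterval => √((x : ℝ) / (1 - (x : ℝ))) := by fun_prop
  have habs : (fun t : ℝ => |t|) =
      (fun x : unitInterval => √((x : ℝ) / (1 - (x : ℝ)))) ∘ compress := by
    ext t
    have h3 : t ^ 2 / (1 + t ^ 2) / (1 - t ^ 2 / (1 + t ^ 2)) = t ^ 2 := by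
      have h4 : (1 + t ^ 2 : ℝ) ≠ 0 := by positivity
      have h5 : 1 - t ^ 2 / (1 + t ^ 2) = 1 / (1 + t ^ 2) := by field_simp; ring
      rw [h5]; field_simp
    simp only [Function.comp_apply, compress]
    rw [h3, Real.sqrt_sq_eq_abs]
  refine hμ.ext_of_map_abs hν ?_
  rw [habs, ← Measure.map_map hg measurable_compress, hP, Measure.map_map hg measurable_compress]

/-! ### A symmetric measure is determined by its R-transform on an interval `(-β, 0)` -/

theorem isPreconnected_slit : IsPreconnected slit := by
  have h : slit = (fun z : ℂ => -z) '' Complex.slitPlane := by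
    ext z
    constructor
    · intro hz; exact ⟨-z, hz, neg_neg z⟩
    · rintro ⟨w, hw, rfl⟩
      change - -w ∈ Complex.slitPlane
      rwa [neg_neg]
  rw [h]
  exact (Complex.starConvex_one_slitPlane.isPathConnected
    Complex.one_mem_slitPlane).isConnected.isPreconnected.image _ (by fun_prop)

theorem continuousAt_rectR {lam : ℝ} {μ : Measure ℝ} {z : ℂ} (hz : z ∈ rectRDomain lam μ) :
    ContinuousAt (rectR lam μ) z := by
  obtain ⟨D, C, hC, hzD⟩ := hz
  refine (hC.analytic z hzD).continuousAt.congr ?_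
  filter_upwards [hC.isOpen.mem_nhds hzD] with w hw
  exact (rectR_eq hC hw).symm

/-- Both `ψ_μ` and `ψ_ν` take the same value at `K x = x / T(C x)`, where `C` is the common
transform. The identity theorem needs these points to accumulate without being constant: `K` is
continuous, and injective because `x = K x * T(ψ_μ(K x))`. -/
theorem IsSymmetric.ext_of_rectR {lam : ℝ} (h0 : 0 ≤ lam) (h1 : lam ≤ 1) {μ ν : Measure ℝ}
    [IsProbabilityMeasure μ] [IsProbabilityMeasure ν] (hμ : IsSymmetric μ) (hν : IsSymmetric ν)
    {β : ℝ} (hβ : 0 < β)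
    (h : ∀ x : ℝ, -β < x → x < 0 → (x : ℂ) ∈ rectRDomain lam μ ∧ (x : ℂ) ∈ rectRDomain lam ν ∧
      rectR lam μ x = rectR lam ν x ∧ ‖rectR lam μ x‖ < 1 / 16) : μ = ν := by
  set K : ℝ → ℂ := fun x => x / rectT lam (rectR lam μ x) with hK
  have hψμ : ∀ x : ℝ, -β < x → x < 0 → psi μ (K x) = rectR lam μ x := fun x hx hx0 =>
    psi_div_rectT_rectR h0 h1 hμ hx0 (h x hx hx0).1
      fun y hy hy0 => (h y (hx.trans_le hy) hy0).2.2.2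
  have hψν : ∀ x : ℝ, -β < x → x < 0 → psi ν (K x) = rectR lam μ x := by
    intro x hx hx0
    have := psi_div_rectT_rectR h0 h1 hν hx0 (h x hx hx0).2.1 fun y hy hy0 => by
      rw [← (h y (hx.trans_le hy) hy0).2.2.1]
      exact (h y (hx.trans_le hy) hy0).2.2.2
    rwa [← (h x hx hx0).2.2.1] at this
  have hinj : ∀ x : ℝ, -β < x → x < 0 → K x * rectT lam (psi μ (K x)) = x := by
    intro x hx hx0
    rw [hψμ x hx hx0]
    exact div_mul_cancel₀ _ (norm_div_rectT_sub_le h0 h1 (h x hx hx0).2.2.2 0).1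
  set x₀ : ℝ := -(β / 2) with hx₀
  have hx1 : -β < x₀ := by rw [hx₀]; linarith
  have hx2 : x₀ < 0 := by rw [hx₀]; linarith
  obtain ⟨hT, hle⟩ := norm_div_rectT_sub_le h0 h1 (h x₀ hx1 hx2).2.2.2 (x₀ : ℂ)
  have hslit : K x₀ ∈ slit := (mem_slit_of_norm_sub_le hx2 hle).1
  have hcont : ContinuousAt K x₀ := by
    have hR : ContinuousAt (fun x : ℝ => rectR lam μ (x : ℂ)) x₀ :=
      ContinuousAt.comp (f := fun x : ℝ => (x : ℂ)) (continuousAt_rectR (h x₀ hx1 hx2).1)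
        Complex.continuous_ofReal.continuousAt
    have hTR : ContinuousAt (fun x : ℝ => rectT lam (rectR lam μ (x : ℂ))) x₀ :=
      ContinuousAt.comp (f := fun x : ℝ => rectR lam μ (x : ℂ))
        (differentiableAt_rectT lam _).continuousAt hR
    exact Complex.continuous_ofReal.continuousAt.div hTR hT
  have hnear : ∀ᶠ x in 𝓝[≠] x₀, (-β < x ∧ x < 0) ∧ x ≠ x₀ :=
    Eventually.and (nhdsWithin_le_nhds ((eventually_gt_nhds hx1).and (eventually_lt_nhds hx2)))
      self_mem_nhdsWithin
  have htend : Tendsto K (𝓝[≠] x₀) (𝓝[≠] (K x₀)) := by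
    refine tendsto_nhdsWithin_iff.2 ⟨hcont.tendsto.mono_left nhdsWithin_le_nhds, ?_⟩
    filter_upwards [hnear] with x hx hKx
    apply hx.2
    have h2 := hinj x hx.1.1 hx.1.2
    rw [show K x = K x₀ from hKx, hinj x₀ hx1 hx2] at h2
    exact_mod_cast h2.symm
  have hfreq : ∃ᶠ z in 𝓝[≠] (K x₀), psi μ z = psi ν z := by
    refine htend.frequently (Eventually.frequently ?_)
    filter_upwards [hnear] with x hx
    rw [hψμ x hx.1.1 hx.1.2, hψν x hx.1.1 hx.1.2]
  exact hμ.ext_of_psi hν (AnalyticOnNhd.eqOn_of_preconnected_of_frequently_eq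
    (fun z hz => analyticAt_psi μ hz) (fun z hz => analyticAt_psi ν hz) isPreconnected_slit
    hslit hfreq)

/-- By the direct part, the R-transform of each subsequential limit is, near `0` on the negative
axis, the pointwise limit of the full sequence of R-transforms. -/
theorem eq_of_tendsto_subseq {lam : ℝ} (h0 : 0 ≤ lam) (h1 : lam ≤ 1)
    {μ : ℕ → ProbabilityMeasure ℝ} (hμ : ∀ n, IsSymmetric (μ n : Measure ℝ)) {β : ℝ} (hβ : 0 < β)
    (hlim : ∀ x : ℝ, -β ≤ x → x < 0 →
      ∃ l : ℂ, Tendsto (fun n : ℕ => rectR lam (μ n : Measure ℝ) (x : ℂ)) atTop (𝓝 l))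
    {φ φ' : ℕ → ℕ} (hφ : Tendsto φ atTop atTop) (hφ' : Tendsto φ' atTop atTop)
    {ν ν' : ProbabilityMeasure ℝ} (hν : Tendsto (fun n => μ (φ n)) atTop (𝓝 ν))
    (hν' : Tendsto (fun n => μ (φ' n)) atTop (𝓝 ν')) : ν = ν' := by
  have hp1 : 0 < Real.pi / 2 := by positivity
  have hp2 : Real.pi / 2 < Real.pi := by linarith
  have hs : IsSymmetric (ν : Measure ℝ) := IsSymmetric.of_tendsto (fun n => hμ (φ n)) hν
  have hs' : IsSymmetric (ν' : Measure ℝ) := IsSymmetric.of_tendsto (fun n => hμ (φ' n)) hν'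
  obtain ⟨b, hb, hdom, -, hu⟩ :=
    exists_tendstoUniformlyOn_rectR h0 h1 (fun n => hμ (φ n)) hν hp1 hp2
  obtain ⟨b', hb', hdom', -, hu'⟩ :=
    exists_tendstoUniformlyOn_rectR h0 h1 (fun n => hμ (φ' n)) hν' hp1 hp2
  obtain ⟨c, hc, hsmall⟩ := (tightSymmetric_singleton hs).exists_forall_rectR h0 h1 hp1 hp2
    (ε := 1 / 16) (by norm_num)
  suffices heq : (ν : Measure ℝ) = (ν' : Measure ℝ) from Subtype.ext heq
  refine hs.ext_of_rectR h0 h1 hs' (β := min (min b b') (min c β)) (by positivity)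
    fun x hx hx0 => ?_
  have hxb : -b < x := by
    linarith [(min_le_left _ _).trans (min_le_left b b') (a := min (min b b') (min c β))]
  have hxb' : -b' < x := by
    linarith [(min_le_left _ _).trans (min_le_right b b') (a := min (min b b') (min c β))]
  have hxc : -c < x := by
    linarith [(min_le_right _ _).trans (min_le_left c β) (a := min (min b b') (min c β))]
  have hxβ : -β ≤ x := by
    linarith [(min_le_right _ _).trans (min_le_right c β) (a := min (min b b') (min c β))]
  have hmem := ofReal_mem_Delta hp1 hx0 hxb
  have hmem' := ofReal_mem_Delta hp1 hx0 hxb'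
  obtain ⟨l, hl⟩ := hlim x hxβ hx0
  have e : rectR lam (ν : Measure ℝ) x = l :=
    tendsto_nhds_unique ((hu {(x : ℂ)} (singleton_subset_iff.2 hmem) isCompact_singleton).tendsto_at
      rfl) (hl.comp hφ)
  have e' : rectR lam (ν' : Measure ℝ) x = l :=
    tendsto_nhds_unique ((hu' {(x : ℂ)} (singleton_subset_iff.2 hmem')
      isCompact_singleton).tendsto_at rfl) (hl.comp hφ')
  exact ⟨hdom hmem, hdom' hmem', e.trans e'.symm,
    ((hsmall _ rfl).2.2 x (ofReal_mem_Delta hp1 hx0 hxc)).2.1⟩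

/-- Tightness gives relative compactness by Prokhorov, and all subsequential limits coincide. -/
theorem exists_tendsto_of_rectR {lam : ℝ} (h0 : 0 ≤ lam) (h1 : lam ≤ 1)
    {μ : ℕ → ProbabilityMeasure ℝ} (hμ : ∀ n, IsSymmetric (μ n : Measure ℝ))
    (h : ∀ ε : ℝ, 0 < ε → ∃ δ : ℝ, 0 < δ ∧ ∀ n : ℕ, ∀ x : ℝ, -δ < x → x < 0 →
      (x : ℂ) ∈ rectRDomain lam (μ n : Measure ℝ) ∧
        ‖rectR lam (μ n : Measure ℝ) (x : ℂ)‖ < ε)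
    {β : ℝ} (hβ : 0 < β)
    (hlim : ∀ x : ℝ, -β ≤ x → x < 0 →
      ∃ l : ℂ, Tendsto (fun n : ℕ => rectR lam (μ n : Measure ℝ) (x : ℂ)) atTop (𝓝 l)) :
    ∃ ν : ProbabilityMeasure ℝ, IsSymmetric (ν : Measure ℝ) ∧ Tendsto μ atTop (𝓝 ν) := by
  have htight := isTightMeasureSet_of_rectR h0 h1 hμ h
  have hcpt : IsCompact (closure (range μ)) := by
    refine isCompact_closure_of_isTightMeasureSet (htight.subset ?_)
    rintro _ ⟨m, ⟨n, rfl⟩, rfl⟩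
    exact ⟨n, rfl⟩
  have hin : ∀ n, μ n ∈ closure (range μ) := fun n => subset_closure (mem_range_self n)
  obtain ⟨ν, -, φ, hφ, hν⟩ := hcpt.tendsto_subseq hin
  have hconv : Tendsto μ atTop (𝓝 ν) := by
    refine tendsto_of_subseq_tendsto fun ns hns => ?_
    obtain ⟨ν', -, ψ, hψ, hν'⟩ := hcpt.tendsto_subseq fun n => hin (ns n)
    refine ⟨ψ, ?_⟩
    rw [eq_of_tendsto_subseq h0 h1 hμ hβ hlim hφ.tendsto_atTop (hns.comp hψ.tendsto_atTop) hν hν']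
    exact hν'
  exact ⟨ν, IsSymmetric.of_tendsto hμ hconv, hconv⟩

end RectFree

end

/-! ### The equivalence of weak convergence and convergence of R-transforms -/

theorem mainTheorem7 (lam : ℝ) (hlam0 : 0 ≤ lam) (hlam1 : lam ≤ 1)
    (μ : ℕ → ProbabilityMeasure ℝ) (hμ : ∀ n, RectFree.IsSymmetric (μ n : Measure ℝ)) :
    List.TFAE [
      -- (i)
      ∃ ν : ProbabilityMeasure ℝ,
        RectFree.IsSymmetric (ν : Measure ℝ) ∧ Tendsto μ atTop (𝓝 ν),
      -- (ii)
      ∃ α β : ℝ, 0 < α ∧ α < Real.pi ∧ 0 < β ∧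
        (∀ ε : ℝ, 0 < ε → ∃ δ : ℝ, 0 < δ ∧ ∀ n : ℕ, ∀ z ∈ RectFree.Delta α δ,
          z ∈ RectFree.rectRDomain lam (μ n) ∧ ‖RectFree.rectR lam (μ n) z‖ < ε) ∧
        (∀ n : ℕ, RectFree.Delta α β ⊆ RectFree.rectRDomain lam (μ n)) ∧
        ∃ f : ℂ → ℂ, ∀ K : Set ℂ, K ⊆ RectFree.Delta α β → IsCompact K →
          TendstoUniformlyOn (fun n : ℕ => RectFree.rectR lam (μ n)) f atTop K,
      -- (iii)
      (∀ ε : ℝ, 0 < ε → ∃ δ : ℝ, 0 < δ ∧ ∀ n : ℕ, ∀ x : ℝ, -δ < x → x < 0 →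
          (x : ℂ) ∈ RectFree.rectRDomain lam (μ n) ∧ ‖RectFree.rectR lam (μ n) (x : ℂ)‖ < ε) ∧
        ∃ β : ℝ, 0 < β ∧ ∀ x : ℝ, -β ≤ x → x < 0 →
          (∀ n : ℕ, (x : ℂ) ∈ RectFree.rectRDomain lam (μ n)) ∧
          ∃ l : ℂ, Tendsto (fun n : ℕ => RectFree.rectR lam (μ n) (x : ℂ)) atTop (𝓝 l)] ∧
    ∀ ν : ProbabilityMeasure ℝ, Tendsto μ atTop (𝓝 ν) →
      ∀ α : ℝ, 0 < α → α < Real.pi → ∃ β : ℝ, 0 < β ∧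
        RectFree.Delta α β ⊆ RectFree.rectRDomain lam ν ∧
        (∀ n : ℕ, RectFree.Delta α β ⊆ RectFree.rectRDomain lam (μ n)) ∧
        ∀ K : Set ℂ, K ⊆ RectFree.Delta α β → IsCompact K →
          TendstoUniformlyOn (fun n : ℕ => RectFree.rectR lam (μ n)) (RectFree.rectR lam ν)
            atTop K := by

  refine ⟨?_, fun ν hν α hα hπ => RectFree.exists_tendstoUniformlyOn_rectR hlam0 hlam1 hμ hν hα hπ⟩
  have hp1 : 0 < Real.pi / 2 := by positivity
  have hp2 : Real.pi / 2 < Real.pi := by linarith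
  tfae_have 1 → 2 := by
    rintro ⟨ν, -, hν⟩
    obtain ⟨β, hβ, -, hdom, hu⟩ :=
      RectFree.exists_tendstoUniformlyOn_rectR hlam0 hlam1 hμ hν hp1 hp2
    -- Any angle in `(0, π)` would serve here.
    refine ⟨Real.pi / 2, β, hp1, hp2, hβ, fun ε hε => ?_, hdom, _, hu⟩
    obtain ⟨δ, hδ, hb⟩ := (RectFree.tightSymmetric_of_tendsto hμ hν).exists_forall_rectR
      hlam0 hlam1 hp1 hp2 hε
    refine ⟨δ, hδ, fun n z hz => ?_⟩
    have hn := hb _ (mem_insert_of_mem _ (mem_range_self n))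
    exact ⟨hn.1 hz, (hn.2.2 z hz).2.1⟩
  tfae_have 2 → 3 := by
    rintro ⟨α, β, hα, -, hβ, hsmall, hdom, f, hf⟩
    -- The interval in (iii) contains its left endpoint while the truncated sector is open, hence `β
    -- / 2`.
    refine ⟨fun ε hε => ?_, β / 2, half_pos hβ, fun x hx hx0 => ?_⟩
    · obtain ⟨δ, hδ, hb⟩ := hsmall ε hε
      exact ⟨δ, hδ, fun n x hx hx0 => hb n x (RectFree.ofReal_mem_Delta hα hx0 hx)⟩
    · have hmem : (x : ℂ) ∈ RectFree.Delta α β :=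
        RectFree.ofReal_mem_Delta hα hx0 (by linarith)
      exact ⟨fun n => hdom n hmem, f x,
        (hf {(x : ℂ)} (singleton_subset_iff.2 hmem) isCompact_singleton).tendsto_at rfl⟩
  tfae_have 3 → 1 := by
    rintro ⟨hsmall, β, hβ, hlim⟩
    exact RectFree.exists_tendsto_of_rectR hlam0 hlam1 hμ hsmall hβ fun x hx hx0 =>
      (hlim x hx hx0).2
  tfae_finish
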